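/- Consider the quasi-static fading channel $\mathbf Y=H\mathbf x+\mathbf Z$, $\mathbf x\in\mathbb C^n$, where the complex fading coefficient $H$ is random but constant over the $n$ channel uses, and $\mathbf Z\sim\mathcal{CN}(\mathbf 0,\mathsf I_n)$ is independent of $H$. Let $G=|H|^2$, let $\rho>0$ and $0<\varepsilon<1$. A code of blocklength $n$ with $M$ messages consists of a (measurable) encoder $f:\{1,\dots,M\}\times\mathbb C\to\mathbb C^n$ and a (measurable) decoder $g:\mathbb C^n\times\mathbb C\to\{1,\dots,M\}$, both of which know $H$ (CSI at transmitter and receiver). It is admissible if, for an equiprobable message $W$ independent of $(H,\mathbf Z)$, it satisfies the long-term power constraint $\mathbb E\|f(W,H)\|^2\le n\rho$ and the average error probability constraint $\mathbb P[g(\mathbf Y,H)\ne W]\le\varepsilon$, with $\mathbf Y=Hf(W,H)+\mathbf Z$. Let $R^*(n,\varepsilon)$ be the supremum of $(\ln M)/n$ over all admissible codes. For $0\le t<1$ put $$F^{-1}(t)=\sup\{g:\mathbb P[G<g]\le t\},\qquad \bar g_t=\mathbb E\!\left[\frac1G\mathbf 1\{G>F^{-1}(t)\}\right]+\frac{\mathbb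 P[G\le F^{-1}(t)]-t}{F^{-1}(t)},$$ and let $C(x)=\ln(1+x)$, $V(x)=\dfrac{x(x+2)}{(x+1)^2}$. Assume that $\mathbb E[G]<\infty$ and that $F^{-1}(\varepsilon-\delta)>0$ for some $\delta\in(0,\varepsilon)$. Then $R^*(n,\varepsilon)$ is finite for every $n\ge1$ and, as $n\to\infty$, $$R^*(n,\varepsilon)=C\!\left(\frac{\rho}{\bar g_\varepsilon}\right)-\sqrt{V\!\left(\frac{\rho}{\bar g_\varepsilon}\right)}\sqrt{\frac{\ln n}{n}}+O\!\left(\frac1{\sqrt n}\right).$$ Moreover, truncated channel inversion achieves this expansion: there are $t_n\to\varepsilon$ and $M_n$ such that, for all large $n$, $0<t_n<\varepsilon$ and there is an admissible code with $M_n$ messages whose encoder uses a fixed codebook $\mathbf c_1,\dots,\mathbf c_{M_n}$ with $\|\mathbf c_j\|^2\le n\rho/\bar g_{t_n}$ and sends $f(j,h)=\mathbf c_j/|h|$ if $|h|^2>F^{-1}(t_n)$, $f(j,h)=\mathbf 0$ if $|h|^2<F^{-1}(t_n)$, and, if $|h|^2=F^{-1}(t_n)$, $\mathbf c_j/|h|$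 for the $j$ in some subset of the messages and $\mathbf 0$ for the others; and $(\ln M_n)/n$ has the same expansion as $R^*(n,\varepsilon)$ above. -/

import Mathlib

open MeasureTheory ProbabilityTheory Filter Topology Asymptotics
open scoped ENNReal NNReal

noncomputable section

namespace QuasiStatic

/-- The circularly symmetric complex Gaussian law `CN(0, 1)`: the real and the imaginary part are
independent real Gaussians with mean `0` and variance `1 / 2`. -/
def complexGaussian : Measure ℂ :=
  ((gaussianReal 0 (1 / 2)).prod (gaussianReal 0 (1 / 2))).map Complex.measurableEquivRealProd.symm

/-- The law `CN(0, I_n)` of the additive noise vector. -/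
def noise (n : ℕ) : Measure (Fin n → ℂ) :=
  Measure.pi fun _ => complexGaussian

/-- The squared Euclidean norm of a vector of `ℂⁿ`. -/
def energy {n : ℕ} (x : Fin n → ℂ) : ℝ :=
  ∑ i, ‖x i‖ ^ 2

/-- The channel gain `G = |H|²`, as a function of the value `h` of the fading coefficient. -/
def gain (h : ℂ) : ℝ :=
  ‖h‖ ^ 2

/-- The output `Y = H x + Z` of the channel, for `H = h` and `Z = z`. -/
def output {n : ℕ} (h : ℂ) (x z : Fin n → ℂ) : Fin n → ℂ :=
  fun i => h * x i + z i

/-- Capacity, in nats, of the complex AWGN channel at signal-to-noise ratio `snr`. -/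
def capacity (snr : ℝ) : ℝ :=
  Real.log (1 + snr)

/-- Dispersion of the complex AWGN channel at signal-to-noise ratio `snr`. -/
def dispersion (snr : ℝ) : ℝ :=
  snr * (snr + 2) / (snr + 1) ^ 2

/-- The generalized inverse `F⁻¹(t) = sup {g : P[G < g] ≤ t}` of the distribution function of the
gain, where `PH` is the law of the fading coefficient `H` (used for `0 ≤ t < 1` only). -/
def genInv (PH : Measure ℂ) (t : ℝ) : ℝ :=
  sSup {g : ℝ | PH.real {h | gain h < g} ≤ t}

/-- `ḡ_t = E[G⁻¹ 1{G > F⁻¹(t)}] + (P[G ≤ F⁻¹(t)] - t) / F⁻¹(t)`. -/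
def avgInvGain (PH : Measure ℂ) (t : ℝ) : ℝ :=
  (∫ h, Set.indicator {h | genInv PH t < gain h} (fun h => 1 / gain h) h ∂PH)
    + (PH.real {h | gain h ≤ genInv PH t} - t) / genInv PH t

/-- An encoder and a decoder of blocklength `n` with `M` messages, both of which know the value of
the fading coefficient (channel state information at the transmitter and at the receiver). -/
structure Code (n M : ℕ) where
  /-- the codeword sent for a message, given the fading coefficient -/
  enc : Fin M → ℂ → (Fin n → ℂ)
  /-- the decoded message, given the channel output and the fading coefficient -/
  dec : (Fin n → ℂ) × ℂ → Fin M
  measurable_enc : ∀ j, Measurable (enc j)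
  measurable_dec : Measurable dec

namespace Code

variable {n M : ℕ}

/-- `E[‖f(W, H)‖²]`, for an equiprobable message `W` independent of `H`. -/
def avgEnergy (c : Code n M) (PH : Measure ℂ) : ℝ≥0∞ :=
  (M : ℝ≥0∞)⁻¹ * ∑ j, ∫⁻ h, ENNReal.ofReal (energy (c.enc j h)) ∂PH

/-- The average error probability `P[g(Y, H) ≠ W]`, for an equiprobable message `W`, where `W`, the
fading coefficient and the noise are independent. -/
def errorProb (c : Code n M) (PH : Measure ℂ) : ℝ :=
  (M : ℝ)⁻¹ * ∑ j, (PH.prod (noise n)).real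
    {p : ℂ × (Fin n → ℂ) | c.dec (output p.1 (c.enc j p.1) p.2, p.1) ≠ j}

/-- The long-term power constraint `ρ` and the average error probability constraint `ε`. -/
def IsAdmissible (c : Code n M) (PH : Measure ℂ) (ρ ε : ℝ) : Prop :=
  c.avgEnergy PH ≤ ENNReal.ofReal (n * ρ) ∧ c.errorProb PH ≤ ε

open scoped Classical in
/-- Truncated channel inversion with threshold `γ` and effective power `ω`: one codebook, which does
not depend on the fading coefficient and obeys the short-term power constraint `ω`, is sent through
a power controller that multiplies the codeword by `1 / |h|` if the gain `|h|²` is above `γ`, and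
silences it if the gain is below `γ`. At the threshold itself, which may have positive probability,
the codewords of a part `S` of the messages are inverted and the others are silenced. -/
def IsTruncatedInversion (c : Code n M) (γ ω : ℝ) : Prop :=
  0 < γ ∧ ∃ (book : Fin M → (Fin n → ℂ)) (S : Finset (Fin M)),
    (∀ j, energy (book j) ≤ n * ω) ∧
    ∀ j h, c.enc j h =
      if γ < gain h ∨ (gain h = γ ∧ j ∈ S) then (fun i => ((‖h‖⁻¹ : ℝ) : ℂ) * book j i) else 0

end Code

/-- The rates `(ln M) / n` of the codes of blocklength `n` that obey the long-term power constraint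
`ρ` and have average error probability at most `ε`. -/
def rateSet (PH : Measure ℂ) (ρ ε : ℝ) (n : ℕ) : Set ℝ :=
  {R | ∃ M : ℕ, (∃ c : Code n M, c.IsAdmissible PH ρ ε) ∧ R = Real.log M / n}

/-- The maximal channel coding rate `R*(n, ε)`. -/
def maxRate (PH : Measure ℂ) (ρ ε : ℝ) (n : ℕ) : ℝ :=
  sSup (rateSet PH ρ ε n)

/-- The first two terms `C(ρ / ḡ_ε) - √(V(ρ / ḡ_ε)) √(ln n / n)` of the expansion. -/
def twoTerms (PH : Measure ℂ) (ρ ε : ℝ) (n : ℕ) : ℝ :=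
  capacity (ρ / avgInvGain PH ε)
    - √(dispersion (ρ / avgInvGain PH ε)) * √(Real.log n / n)

end QuasiStatic

end

noncomputable section

namespace QuasiStatic

/-! The long-term power constraint turns the problem into a fractional knapsack. Received energy nω
at gain g costs transmitted energy nω/g, so a given probability of transmission is cheapest when the
strongest gains are served first. F⁻¹(t) is the Lagrange multiplier and ḡ_t the least mean inverse
gain for transmission probability 1 - t (`integral_le_of_transmission`). After inversion the channel
is AWGN with signal-to-noise ratio ρ/ḡ_t.

The logarithm comes from trading outage against decoding errors. Lowering the outage level from ε to
ε - O(1/√n) changes ḡ by O(1/√n) (`avgInvGain_le_add`) and hence ln M by O(√n), which the remainder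
absorbs. So decoding errors may be reduced to order 1/√n. This is the Gaussian tail at √(ln n)
standard deviations, and the AWGN code pays √(nV ln n) nats for it. Achievability combines
Feinstein's construction (`exists_codebook`, `exists_awgn_code`) with inversion
(`exists_inversionCode`).

For the converse, put w = ρ/ḡ_ε. A codeword of received energy E exceeds the information threshold
nC(w) - √(nV ln n) + O(√n) with probability at most E/(nω) + 2/√n, where ω = w + K/√n
(`eventually_infoDensity_spectrum_le`). Thus min(1, E/(nω)) acts as a transmission probability in
the knapsack, whose optimality bounds the success probability (`converse_of_spectrum`).

All tail estimates start from the exact moment generating function of the information density, which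
depends on the input only through its energy. Chernoff bounds give the upper estimates and
exponential tilting the lower ones. Factors of order √n in M are harmless, as they cost only ln √n ≤
√n. -/

lemma energy_nonneg {n : ℕ} (x : Fin n → ℂ) : 0 ≤ energy x :=
  Finset.sum_nonneg fun _ _ => sq_nonneg _

@[fun_prop]
lemma continuous_energy {n : ℕ} : Continuous (energy : (Fin n → ℂ) → ℝ) := by
  unfold energy; fun_prop

@[fun_prop]
lemma measurable_energy {n : ℕ} : Measurable (energy : (Fin n → ℂ) → ℝ) :=
  continuous_energy.measurable

@[fun_prop]
lemma measurable_gain : Measurable gain := by unfold gain; fun_prop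

lemma gain_nonneg (h : ℂ) : 0 ≤ gain h := sq_nonneg _

lemma energy_zero {n : ℕ} : energy (0 : Fin n → ℂ) = 0 := by simp [energy]

lemma energy_mul {n : ℕ} (h : ℂ) (x : Fin n → ℂ) :
    energy (fun i => h * x i) = gain h * energy x := by
  simp [energy, gain, Finset.mul_sum, mul_pow]

/-! ### Gaussian vectors in ℂⁿ: densities, rotations, convolution -/

lemma exp_neg_mul_energy {n : ℕ} (b : ℝ) (m z : Fin n → ℂ) :
    Real.exp (-b * energy (z - m)) = ∏ i, Real.exp (-b * ‖z i - m i‖ ^ 2) := by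
  rw [← Real.exp_sum, energy, Finset.mul_sum]; rfl

lemma integrable_exp_neg_mul_sq_norm {b : ℝ} (hb : 0 < b) (m : ℂ) :
    Integrable (fun z : ℂ => Real.exp (-b * ‖z - m‖ ^ 2)) := by
  have h : Integrable (fun z : ℂ => Real.exp (-b * ‖z‖ ^ 2)) := by
    refine Integrable.of_integral_ne_zero ?_
    rw [GaussianFourier.integral_rexp_neg_mul_sq_norm hb]
    positivity
  exact h.comp_sub_right m

lemma integral_exp_neg_mul_sq_norm {b : ℝ} (hb : 0 < b) (m : ℂ) :
    ∫ z : ℂ, Real.exp (-b * ‖z - m‖ ^ 2) = Real.pi / b := by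
  rw [integral_sub_right_eq_self (fun z : ℂ => Real.exp (-b * ‖z‖ ^ 2)) m,
    GaussianFourier.integral_rexp_neg_mul_sq_norm hb]
  simp

lemma integrable_exp_neg_mul_energy {n : ℕ} {b : ℝ} (hb : 0 < b) (m : Fin n → ℂ) :
    Integrable (fun z : Fin n → ℂ => Real.exp (-b * energy (z - m))) := by
  simp_rw [exp_neg_mul_energy]
  exact Integrable.fintype_prod (f := fun i z => Real.exp (-b * ‖z - m i‖ ^ 2))
    fun i => integrable_exp_neg_mul_sq_norm hb (m i)

lemma integral_exp_neg_mul_energy {n : ℕ} {b : ℝ} (hb : 0 < b) (m : Fin n → ℂ) :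
    ∫ z : Fin n → ℂ, Real.exp (-b * energy (z - m)) = (Real.pi / b) ^ n := by
  simp_rw [exp_neg_mul_energy]
  rw [integral_fintype_prod_volume_eq_prod (fun i z => Real.exp (-b * ‖z - m i‖ ^ 2))]
  rw [Finset.prod_congr rfl fun i _ => integral_exp_neg_mul_sq_norm hb (m i)]
  simp [div_pow]

/-- The density of the law `CN(m, v I_n)`. -/
def gaussDensity {n : ℕ} (v : ℝ) (m z : Fin n → ℂ) : ℝ :=
  (Real.pi * v)⁻¹ ^ n * Real.exp (-v⁻¹ * energy (z - m))

/-- The law `CN(m, v I_n)`. -/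
def gaussVec {n : ℕ} (v : ℝ) (m : Fin n → ℂ) : Measure (Fin n → ℂ) :=
  volume.withDensity fun z => ENNReal.ofReal (gaussDensity v m z)

lemma gaussDensity_nonneg {n : ℕ} {v : ℝ} (hv : 0 < v) (m z : Fin n → ℂ) :
    0 ≤ gaussDensity v m z := by unfold gaussDensity; positivity

@[fun_prop]
lemma continuous_gaussDensity {n : ℕ} (v : ℝ) :
    Continuous fun p : (Fin n → ℂ) × (Fin n → ℂ) => gaussDensity v p.1 p.2 := by
  unfold gaussDensity; fun_prop

@[fun_prop]
lemma measurable_gaussDensity {n : ℕ} (v : ℝ) (m : Fin n → ℂ) :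
    Measurable fun z => gaussDensity v m z := by
  unfold gaussDensity; fun_prop

lemma integrable_gaussDensity {n : ℕ} {v : ℝ} (hv : 0 < v) (m : Fin n → ℂ) :
    Integrable (fun z => gaussDensity v m z) :=
  (integrable_exp_neg_mul_energy (inv_pos.2 hv) m).const_mul _

lemma integral_gaussDensity {n : ℕ} {v : ℝ} (hv : 0 < v) (m : Fin n → ℂ) :
    ∫ z, gaussDensity v m z = 1 := by
  unfold gaussDensity
  rw [integral_const_mul, integral_exp_neg_mul_energy (inv_pos.2 hv) m, ← mul_pow]
  have := Real.pi_pos.ne'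
  rw [show (Real.pi * v)⁻¹ * (Real.pi / v⁻¹) = 1 by field_simp, one_pow]

lemma lintegral_gaussDensity {n : ℕ} {v : ℝ} (hv : 0 < v) (m : Fin n → ℂ) :
    ∫⁻ z, ENNReal.ofReal (gaussDensity v m z) = 1 := by
  rw [← ofReal_integral_eq_lintegral_ofReal (integrable_gaussDensity hv m)
    (ae_of_all _ fun z => gaussDensity_nonneg hv m z), integral_gaussDensity hv]
  simp

lemma isProbabilityMeasure_gaussVec {n : ℕ} {v : ℝ} (hv : 0 < v) (m : Fin n → ℂ) :
    IsProbabilityMeasure (gaussVec v m) :=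
  ⟨by rw [gaussVec, withDensity_apply _ MeasurableSet.univ, Measure.restrict_univ,
    lintegral_gaussDensity hv]⟩

lemma integral_gaussVec {n : ℕ} {v : ℝ} (hv : 0 < v) (m : Fin n → ℂ) (f : (Fin n → ℂ) → ℝ) :
    ∫ z, f z ∂gaussVec v m = ∫ z, gaussDensity v m z * f z := by
  rw [gaussVec, integral_withDensity_eq_integral_toReal_smul
    (by fun_prop) (ae_of_all _ fun _ => ENNReal.ofReal_lt_top)]
  simp [ENNReal.toReal_ofReal (gaussDensity_nonneg hv m _)]

lemma integrable_gaussVec_iff {n : ℕ} {v : ℝ} (hv : 0 < v) (m : Fin n → ℂ)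
    (f : (Fin n → ℂ) → ℝ) :
    Integrable f (gaussVec v m) ↔ Integrable fun z => gaussDensity v m z * f z := by
  rw [gaussVec, integrable_withDensity_iff_integrable_smul'
    (by fun_prop) (ae_of_all _ fun _ => ENNReal.ofReal_lt_top)]
  simp [ENNReal.toReal_ofReal (gaussDensity_nonneg hv m _)]

lemma complexGaussian_eq : complexGaussian =
    volume.withDensity fun z : ℂ => ENNReal.ofReal (Real.pi⁻¹ * Real.exp (-1 * ‖z - 0‖ ^ 2)) := by
  have h2 : (1 / 2 : ℝ≥0) ≠ 0 := by norm_num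
  rw [complexGaussian, gaussianReal_of_var_ne_zero _ h2,
    prod_withDensity (measurable_gaussianPDF _ _) (measurable_gaussianPDF _ _)]
  rw [← (Complex.volume_preserving_equiv_real_prod.symm).map_eq]
  ext s hs
  rw [Measure.map_apply Complex.measurableEquivRealProd.symm.measurable hs,
    withDensity_apply _ (Complex.measurableEquivRealProd.symm.measurable hs),
    withDensity_apply _ hs, Measure.restrict_map Complex.measurableEquivRealProd.symm.measurable hs,
    lintegral_map (by fun_prop) Complex.measurableEquivRealProd.symm.measurable]
  refine lintegral_congr fun p => ?_
  rw [gaussianPDF, gaussianPDF, ← ENNReal.ofReal_mul (gaussianPDFReal_nonneg _ _ _)]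
  congr 1
  have hp : (0 : ℝ) < Real.pi := Real.pi_pos
  rw [gaussianPDFReal, gaussianPDFReal, mul_mul_mul_comm, ← Real.exp_add, Complex.sq_norm,
    Complex.normSq_apply, ← mul_inv]
  have e1 : (2 : ℝ) * Real.pi * ((1 / 2 : ℝ≥0) : ℝ) = Real.pi := by push_cast; ring
  rw [e1, Real.mul_self_sqrt hp.le]
  congr 2
  simp [Complex.measurableEquivRealProd]
  ring

instance : IsProbabilityMeasure complexGaussian := by
  unfold complexGaussian
  exact Measure.isProbabilityMeasure_map (by fun_prop)

instance (n : ℕ) : IsProbabilityMeasure (noise n) := by unfold noise; infer_instance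

/-- Replaces the product law by a Lebesgue density, so that expectations under the noise become
explicit Gaussian integrals. -/
lemma noise_eq_gaussVec (n : ℕ) : noise n = gaussVec 1 0 := by
  have := isProbabilityMeasure_gaussVec (n := n) one_pos 0
  refine Measure.pi_eq fun s hs => ?_
  rw [gaussVec, withDensity_apply _ (MeasurableSet.univ_pi hs), volume_pi, Measure.restrict_pi_pi]
  have h1 : ∀ z : Fin n → ℂ, gaussDensity 1 0 z =
      ∏ i, (Real.pi⁻¹ * Real.exp (-1 * ‖z i - 0‖ ^ 2)) := by
    intro z
    rw [gaussDensity, inv_one, exp_neg_mul_energy, Finset.prod_mul_distrib]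
    simp
  have hint : ∀ i, Integrable (fun z : ℂ => Real.pi⁻¹ * Real.exp (-1 * ‖z - 0‖ ^ 2))
      (volume.restrict (s i)) := fun i =>
    ((integrable_exp_neg_mul_sq_norm one_pos 0).const_mul _).mono_measure Measure.restrict_le_self
  simp_rw [h1]
  rw [← ofReal_integral_eq_lintegral_ofReal
    (Integrable.fintype_prod (f := fun _ z => Real.pi⁻¹ * Real.exp (-1 * ‖z - 0‖ ^ 2)) hint)
    (ae_of_all _ fun z => Finset.prod_nonneg fun i _ => by positivity),
    integral_fintype_prod_eq_prod (fun _ z => Real.pi⁻¹ * Real.exp (-1 * ‖z - 0‖ ^ 2)),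
    ENNReal.ofReal_prod_of_nonneg fun i _ => integral_nonneg fun z => by positivity]
  refine Finset.prod_congr rfl fun i _ => ?_
  rw [ofReal_integral_eq_lintegral_ofReal (hint i) (ae_of_all _ fun z => by positivity),
    complexGaussian_eq, withDensity_apply _ (hs i)]

lemma noise_preimage_add {n : ℕ} (x : Fin n → ℂ) {A : Set (Fin n → ℂ)} (hA : MeasurableSet A) :
    noise n {z | x + z ∈ A} = gaussVec 1 x A := by
  have hA' : MeasurableSet {z | x + z ∈ A} := measurable_const_add x hA
  rw [noise_eq_gaussVec, gaussVec, gaussVec, withDensity_apply _ hA', withDensity_apply _ hA,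
    ← lintegral_indicator hA', ← lintegral_indicator hA,
    ← lintegral_add_left_eq_self (A.indicator _) x]
  refine lintegral_congr fun z => ?_
  by_cases h : x + z ∈ A
  · rw [Set.indicator_of_mem h, Set.indicator_of_mem (show z ∈ {z | x + z ∈ A} from h)]
    simp [gaussDensity]
  · rw [Set.indicator_of_notMem h, Set.indicator_of_notMem (show z ∉ {z | x + z ∈ A} from h)]

/-- The density depends only on the modulus, and Lebesgue measure is rotation invariant. This lets
the receiver undo the phase of the channel while the transmitter divides by its modulus only. -/
lemma measurePreserving_rotate (u : ℂ) (hu : ‖u‖ = 1) :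
    MeasurePreserving (fun z : ℂ => u * z) complexGaussian complexGaussian := by
  have hv : MeasurePreserving (fun z : ℂ => u * z) volume volume :=
    (rotation ⟨u, mem_sphere_zero_iff_norm.2 hu⟩).measurePreserving
  refine ⟨by fun_prop, ?_⟩
  have hm : Measurable (fun z : ℂ => u * z) := by fun_prop
  ext s hs
  rw [Measure.map_apply hm hs, complexGaussian_eq, withDensity_apply _ (hm hs),
    withDensity_apply _ hs]
  conv_rhs => rw [← hv.map_eq]
  rw [Measure.restrict_map hm hs, lintegral_map (by fun_prop) hm]
  simp [hu]

lemma measurePreserving_rotate_noise {n : ℕ} (u : ℂ) (hu : ‖u‖ = 1) :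
    MeasurePreserving (fun (z : Fin n → ℂ) i => u * z i) (noise n) (noise n) :=
  measurePreserving_pi _ _ fun _ => measurePreserving_rotate u hu

/-- The average of `CN(x, I)` over `x ~ CN(0, w I)` is `CN(0, (1 + w) I)`. -/
lemma lintegral_gaussVec_one {n : ℕ} {w : ℝ} (hw : 0 < w) {A : Set (Fin n → ℂ)}
    (hA : MeasurableSet A) :
    ∫⁻ x, gaussVec 1 x A ∂(gaussVec w 0) = gaussVec (1 + w) 0 A := by
  have hmeas : Measurable fun p : (Fin n → ℂ) × (Fin n → ℂ) =>
      ENNReal.ofReal (gaussDensity 1 p.1 p.2) :=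
    ((continuous_gaussDensity 1).measurable).ennreal_ofReal
  simp_rw [gaussVec, withDensity_apply _ hA]
  rw [lintegral_withDensity_eq_lintegral_mul _ (by fun_prop) hmeas.lintegral_prod_right']
  simp only [Pi.mul_apply]
  simp_rw [← lintegral_const_mul' _ _ ENNReal.ofReal_ne_top]
  rw [lintegral_lintegral_swap]
  · refine lintegral_congr fun y => ?_
    -- Bayes' rule for Gaussians: prior times likelihood equals the output density times the
    -- posterior CN(w y/(1+w), (w/(1+w)) I), which integrates to 1 in x.
    have key : ∀ x : Fin n → ℂ, ENNReal.ofReal (gaussDensity w 0 x) *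
        ENNReal.ofReal (gaussDensity 1 x y) = ENNReal.ofReal (gaussDensity (1 + w) 0 y) *
        ENNReal.ofReal (gaussDensity (w / (1 + w)) (fun i => ((w / (1 + w) : ℝ) : ℂ) * y i) x) := by
      intro x
      rw [← ENNReal.ofReal_mul (gaussDensity_nonneg hw _ _),
        ← ENNReal.ofReal_mul (gaussDensity_nonneg (by positivity) _ _)]
      congr 1
      simp only [gaussDensity]
      rw [mul_mul_mul_comm, mul_mul_mul_comm _ _ (_ ^ n), ← Real.exp_add, ← Real.exp_add,
        ← mul_pow, ← mul_pow]
      congr 2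
      · have := Real.pi_pos.ne'
        field_simp
      · simp only [energy, Finset.mul_sum, ← Finset.sum_add_distrib]
        refine Finset.sum_congr rfl fun i _ => ?_
        simp only [Pi.sub_apply, Complex.sq_norm, Complex.normSq_apply, Complex.sub_re,
          Complex.sub_im, Pi.zero_apply, Complex.zero_re, Complex.zero_im, Complex.re_ofReal_mul,
          Complex.im_ofReal_mul]
        field_simp
        ring
    simp_rw [key]
    rw [lintegral_const_mul' _ _ ENNReal.ofReal_ne_top, lintegral_gaussDensity (by positivity),
      mul_one]
  · refine AEMeasurable.mul ?_ hmeas.aemeasurable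
    exact (Measurable.ennreal_ofReal (by fun_prop)).aemeasurable

/-! ### Information density: moment generating function and changes of measure -/

/-- The information density between the input `x` and the output `x + z`, computed with respect to
the output law `CN(0, (1 + w) I)`. -/
def infoDensity {n : ℕ} (w : ℝ) (x z : Fin n → ℂ) : ℝ :=
  n * Real.log (1 + w) + energy (x + z) / (1 + w) - energy z

/-- The mean of the information density of an input of energy `E`. -/
def infoMean (n : ℕ) (w E : ℝ) : ℝ :=
  n * Real.log (1 + w) + (E - n * w) / (1 + w)

/-- The cumulant generating function of the centered information density, with the sign of the
argument reversed. -/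
def infoCgf (n : ℕ) (w E s : ℝ) : ℝ :=
  n * (-Real.log (1 - s * w / (1 + w)) - s * w / (1 + w))
    + s ^ 2 * E / ((1 + w) ^ 2 * (1 - s * w / (1 + w)))

@[fun_prop]
lemma measurable_infoDensity {n : ℕ} (w : ℝ) (x : Fin n → ℂ) :
    Measurable fun z => infoDensity w x z := by
  unfold infoDensity; fun_prop

/-- Completing the square in z. The quadratic coefficient is -(1 - s w/(1+w)), negative under `hs`,
and x only shifts the centre and contributes a factor depending on its energy. -/
lemma gaussDensity_mul_exp_infoDensity {n : ℕ} {w s : ℝ} (hw : 0 < w) (hs : s * w / (1 + w) < 1)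
    (x z : Fin n → ℂ) :
    gaussDensity 1 0 z * Real.exp (-s * (infoDensity w x z - infoMean n w (energy x))) =
      (Real.pi⁻¹ ^ n * Real.exp (s ^ 2 * energy x / ((1 + w) ^ 2 * (1 - s * w / (1 + w)))
        - n * (s * w / (1 + w)))) * Real.exp (-(1 - s * w / (1 + w)) *
          energy (z - fun i => ((-(s / ((1 + w) * (1 - s * w / (1 + w)))) : ℝ) : ℂ) * x i)) := by
  have hw1 : (1 + w) ≠ 0 := by positivity
  obtain ⟨b, hb⟩ : ∃ b, b = 1 - s * w / (1 + w) := ⟨_, rfl⟩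
  have hb0 : b ≠ 0 := by linarith
  have hsw : s * w / (1 + w) = 1 - b := by linarith
  have hsb : s = (1 - b) * (1 + w) / w := by rw [← hsw]; field_simp
  rw [hsw, gaussDensity, mul_one, inv_one, mul_assoc, mul_assoc, ← Real.exp_add, ← Real.exp_add]
  congr 2
  have hn : (n : ℝ) * (1 - b) = s * (n * w / (1 + w)) := by rw [← hsw]; ring
  simp only [infoDensity, infoMean, hn]
  have key : -1 * energy (z - 0) + -s * (energy (x + z) / (1 + w) - energy z
      - energy x / (1 + w)) = s ^ 2 * energy x / ((1 + w) ^ 2 * (1 - (1 - b))) +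
      -(1 - (1 - b)) * energy (z - fun i =>
        ((-(s / ((1 + w) * (1 - (1 - b)))) : ℝ) : ℂ) * x i) := by
    have hkey : ∀ i, -1 * ‖(z - 0) i‖ ^ 2 + -s * (‖(x + z) i‖ ^ 2 / (1 + w) - ‖z i‖ ^ 2
      - ‖x i‖ ^ 2 / (1 + w)) = s ^ 2 * ‖x i‖ ^ 2 / ((1 + w) ^ 2 * (1 - (1 - b))) +
      -(1 - (1 - b)) * ‖(z - fun i =>
        ((-(s / ((1 + w) * (1 - (1 - b)))) : ℝ) : ℂ) * x i) i‖ ^ 2 := by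
      intro i
      simp only [sub_sub_cancel, Pi.sub_apply, Pi.add_apply, Complex.sq_norm,
        Complex.normSq_apply, Complex.sub_re, Complex.add_re, Complex.add_im,
        Complex.sub_im, Pi.zero_apply, Complex.zero_re, Complex.zero_im, Complex.re_ofReal_mul,
        Complex.im_ofReal_mul]
      rw [hsb]
      field_simp
      ring
    simp only [energy, Finset.mul_sum, Finset.sum_div, ← Finset.sum_add_distrib,
      ← Finset.sum_sub_distrib]
    exact Finset.sum_congr rfl fun i _ => hkey i
  linear_combination key

lemma integrable_exp_infoDensity {n : ℕ} {w s : ℝ} (hw : 0 < w) (hs : s * w / (1 + w) < 1)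
    (x : Fin n → ℂ) :
    Integrable (fun z => Real.exp (-s * (infoDensity w x z - infoMean n w (energy x))))
      (noise n) := by
  rw [noise_eq_gaussVec, integrable_gaussVec_iff one_pos]
  simp_rw [gaussDensity_mul_exp_infoDensity hw hs]
  exact (integrable_exp_neg_mul_energy (by linarith) _).const_mul _

/-- Translation invariance removes the centre of the completed square, so only the energy of x
survives. This makes all later tail bounds uniform over inputs of comparable energy. -/
lemma integral_exp_infoDensity {n : ℕ} {w s : ℝ} (hw : 0 < w) (hs : s * w / (1 + w) < 1)
    (x : Fin n → ℂ) :
    ∫ z, Real.exp (-s * (infoDensity w x z - infoMean n w (energy x))) ∂noise n =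
      Real.exp (infoCgf n w (energy x) s) := by
  have hb : 0 < 1 - s * w / (1 + w) := by linarith
  rw [noise_eq_gaussVec, integral_gaussVec one_pos]
  simp_rw [gaussDensity_mul_exp_infoDensity hw hs]
  rw [integral_const_mul, integral_exp_neg_mul_energy hb]
  have : Real.pi⁻¹ ^ n * (Real.pi / (1 - s * w / (1 + w))) ^ n =
      Real.exp (n * -Real.log (1 - s * w / (1 + w))) := by
    rw [← mul_pow, Real.exp_nat_mul, Real.exp_neg, Real.exp_log hb]
    congr 1
    have := Real.pi_pos.ne'
    field_simp
  rw [mul_right_comm, this, ← Real.exp_add, infoCgf]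
  congr 1
  ring

/-- The information density is the exact log-likelihood ratio of CN(x, I) against CN(0, (1+w) I),
whatever the energy of x; both changes of measure below rest on this. -/
lemma gaussDensity_one_eq {n : ℕ} {w : ℝ} (hw : 0 < w) (x y : Fin n → ℂ) :
    gaussDensity 1 x y = Real.exp (infoDensity w x (y - x)) * gaussDensity (1 + w) 0 y := by
  have h1 : (0 : ℝ) < 1 + w := by positivity
  have hn : Real.exp (n * Real.log (1 + w)) = (1 + w) ^ n := by
    rw [Real.exp_nat_mul, Real.exp_log h1]
  rw [gaussDensity, gaussDensity, infoDensity, add_sub_assoc, Real.exp_add, hn,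
    mul_mul_mul_comm, ← Real.exp_add, ← mul_pow]
  congr 2
  · have := Real.pi_pos.ne'
    field_simp
  · simp
    ring

/-- A change of measure from `CN(x, I)` to `CN(0, (1 + w) I)`. -/
lemma noise_infoDensity_le {n : ℕ} {w : ℝ} (hw : 0 < w) (x : Fin n → ℂ) (T : ℝ)
    {D : Set (Fin n → ℂ)} (hD : MeasurableSet D) :
    noise n {z | x + z ∈ D ∧ infoDensity w x z ≤ T} ≤
      ENNReal.ofReal (Real.exp T) * gaussVec (1 + w) 0 D := by
  have hm : Measurable fun y => infoDensity w x (y - x) := by fun_prop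
  have hA : MeasurableSet (D ∩ {y | infoDensity w x (y - x) ≤ T}) :=
    hD.inter (measurableSet_le hm measurable_const)
  have h := noise_preimage_add x hA
  simp only [Set.mem_inter_iff, Set.mem_ofPred_eq, add_sub_cancel_left] at h
  rw [h, gaussVec, gaussVec, withDensity_apply _ hA, withDensity_apply _ hD,
    ← lintegral_const_mul _ (by fun_prop)]
  refine (setLIntegral_mono (by fun_prop) fun y hy => ?_).trans
    (lintegral_mono_set Set.inter_subset_left)
  rw [gaussDensity_one_eq hw, ← ENNReal.ofReal_mul (Real.exp_pos _).le]
  refine ENNReal.ofReal_le_ofReal (mul_le_mul_of_nonneg_right (Real.exp_le_exp.2 hy.2) ?_)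
  exact gaussDensity_nonneg (by positivity) _ _

/-- On this set the density of CN(0, (1+w) I) is at most exp(-T) times that of CN(x, I), which has
mass 1. It caps the size of a decoding region in Feinstein's argument. -/
lemma gaussVec_lt_infoDensity_le {n : ℕ} {w : ℝ} (hw : 0 < w) (x : Fin n → ℂ) (T : ℝ) :
    gaussVec (1 + w) 0 {y | T < infoDensity w x (y - x)} ≤ ENNReal.ofReal (Real.exp (-T)) := by
  have hm : Measurable fun y => infoDensity w x (y - x) := by fun_prop
  have hA : MeasurableSet {y | T < infoDensity w x (y - x)} := measurableSet_lt measurable_const hm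
  have := isProbabilityMeasure_gaussVec one_pos x
  rw [gaussVec, withDensity_apply _ hA]
  calc _ ≤ ∫⁻ y in {y | T < infoDensity w x (y - x)},
        ENNReal.ofReal (Real.exp (-T)) * ENNReal.ofReal (gaussDensity 1 x y) := by
        refine setLIntegral_mono (by fun_prop) fun y hy => ?_
        rw [gaussDensity_one_eq hw, ← ENNReal.ofReal_mul (Real.exp_pos _).le, ← mul_assoc,
          ← Real.exp_add]
        refine ENNReal.ofReal_le_ofReal (le_mul_of_one_le_left
          (gaussDensity_nonneg (by positivity) _ _) (Real.one_le_exp ?_))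
        have : T < infoDensity w x (y - x) := hy
        linarith
    _ = ENNReal.ofReal (Real.exp (-T)) * gaussVec 1 x {y | T < infoDensity w x (y - x)} := by
        rw [lintegral_const_mul _ (by fun_prop), gaussVec, withDensity_apply _ hA]
    _ ≤ _ := mul_le_of_le_one_right' prob_le_one

/-! ### Tail estimates from moment generating functions -/

/-- A lower bound for the probability of a window, from estimates of the moment generating
function at three points: exponential tilting to the middle of the window. -/
lemma le_measureReal_window {Ω : Type*} [MeasurableSpace Ω] {P : Measure Ω}
    [IsProbabilityMeasure P] {Y : Ω → ℝ} (hY : Measurable Y) {s : ℝ} (hs : 0 ≤ s)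
    (hint : ∀ r, |r - s| ≤ 2 → Integrable (fun x => Real.exp (-r * Y x)) P)
    (hlow : Real.exp (s ^ 2 / 2 - 1 / 4) ≤ ∫ x, Real.exp (-s * Y x) ∂P)
    (hup : ∀ r, |r - s| ≤ 2 → ∫ x, Real.exp (-r * Y x) ∂P ≤ Real.exp (r ^ 2 / 2 + 1 / 4)) :
    1 / 4 * Real.exp (-s ^ 2 / 2 - 2 * s) ≤ P.real {x | -2 - s ≤ Y x ∧ Y x ≤ 2 - s} := by
  have hW : MeasurableSet {x | -2 - s ≤ Y x ∧ Y x ≤ 2 - s} :=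
    (measurableSet_le measurable_const hY).inter (measurableSet_le hY measurable_const)
  have i0 := hint s (by simp)
  have i1 := hint (s - 2) (by norm_num)
  have i2 := hint (s + 2) (by norm_num)
  have u1 := hup (s - 2) (by norm_num)
  have u2 := hup (s + 2) (by norm_num)
  -- Inside the window the first term is at most 1. Outside, it is dominated by the term with tilt s
  -- - 2 (on the right) or s + 2 (on the left): these are the Chernoff bounds for the two tails of
  -- the tilted law.
  have hpt : ∀ x, Real.exp (-2 * s - s ^ 2) * Real.exp (-s * Y x)
      - Real.exp (-s ^ 2 - 4) * Real.exp (-(s - 2) * Y x)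
      - Real.exp (-4 * s - s ^ 2 - 4) * Real.exp (-(s + 2) * Y x) ≤
      {x | -2 - s ≤ Y x ∧ Y x ≤ 2 - s}.indicator (fun _ => (1 : ℝ)) x := by
    intro x
    simp only [← Real.exp_add]
    have p1 := Real.exp_pos (-s ^ 2 - 4 + -(s - 2) * Y x)
    have p2 := Real.exp_pos (-4 * s - s ^ 2 - 4 + -(s + 2) * Y x)
    by_cases hx : -2 - s ≤ Y x ∧ Y x ≤ 2 - s
    · rw [Set.indicator_of_mem (show x ∈ {x | -2 - s ≤ Y x ∧ Y x ≤ 2 - s} from hx)]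
      have : Real.exp (-2 * s - s ^ 2 + -s * Y x) ≤ 1 :=
        Real.exp_le_one_iff.2 (by nlinarith [hx.1])
      linarith
    · rw [Set.indicator_of_notMem (show x ∉ {x | -2 - s ≤ Y x ∧ Y x ≤ 2 - s} from hx)]
      rcases lt_or_ge (Y x) (-2 - s) with h | h
      · have : Real.exp (-2 * s - s ^ 2 + -s * Y x) ≤
            Real.exp (-4 * s - s ^ 2 - 4 + -(s + 2) * Y x) := Real.exp_le_exp.2 (by nlinarith)
        linarith
      · have h' : 2 - s < Y x := by
          by_contra h'
          exact hx ⟨h, not_lt.1 h'⟩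
        have : Real.exp (-2 * s - s ^ 2 + -s * Y x) ≤
            Real.exp (-s ^ 2 - 4 + -(s - 2) * Y x) := Real.exp_le_exp.2 (by nlinarith)
        linarith
  have hmono := integral_mono (((i0.const_mul _).sub (i1.const_mul _)).sub (i2.const_mul _))
    ((integrable_const (1 : ℝ)).indicator hW) hpt
  rw [integral_indicator_const _ hW, smul_eq_mul, mul_one] at hmono
  refine le_trans ?_ hmono
  rw [integral_sub' ((i0.const_mul _).sub (i1.const_mul _)) (i2.const_mul _),
    integral_sub' (i0.const_mul _) (i1.const_mul _), integral_const_mul, integral_const_mul,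
    integral_const_mul]
  have v0 := mul_le_mul_of_nonneg_left hlow (Real.exp_pos (-2 * s - s ^ 2)).le
  have v1 := mul_le_mul_of_nonneg_left u1 (Real.exp_pos (-s ^ 2 - 4)).le
  have v2 := mul_le_mul_of_nonneg_left u2 (Real.exp_pos (-4 * s - s ^ 2 - 4)).le
  rw [← Real.exp_add] at v0 v1 v2
  -- All three terms share the factor exp(-s²/2 - 2s); what remains is e^(-1/4) - 2e^(-7/4) ≥ 3/4 -
  -- 2/4.
  have e0 : Real.exp (-2 * s - s ^ 2 + (s ^ 2 / 2 - 1 / 4)) =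
      Real.exp (-s ^ 2 / 2 - 2 * s) * Real.exp (-1 / 4) := by
    rw [← Real.exp_add]; ring_nf
  have e1 : Real.exp (-s ^ 2 - 4 + ((s - 2) ^ 2 / 2 + 1 / 4)) =
      Real.exp (-s ^ 2 / 2 - 2 * s) * Real.exp (-7 / 4) := by
    rw [← Real.exp_add]; ring_nf
  have e2 : Real.exp (-4 * s - s ^ 2 - 4 + ((s + 2) ^ 2 / 2 + 1 / 4)) =
      Real.exp (-s ^ 2 / 2 - 2 * s) * Real.exp (-7 / 4) := by
    rw [← Real.exp_add]; ring_nf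
  rw [e0] at v0
  rw [e1] at v1
  rw [e2] at v2
  have c0 : (3 : ℝ) / 4 ≤ Real.exp (-1 / 4) := by
    have := Real.add_one_le_exp (-1 / 4 : ℝ); linarith
  have c1 : Real.exp (-7 / 4) ≤ 1 / 4 := by
    have h4 : (4 : ℝ) ≤ Real.exp (7 / 4) := by
      have h1 := Real.exp_one_gt_d9
      have h2 : (4 : ℝ) ^ 4 ≤ Real.exp (7 / 4) ^ 4 := by
        rw [← Real.exp_nat_mul, show ((4 : ℕ) : ℝ) * (7 / 4) = ((7 : ℕ) : ℝ) * 1 by norm_num,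
          Real.exp_nat_mul]
        calc (4 : ℝ) ^ 4 ≤ 2.7 ^ 7 := by norm_num
          _ ≤ _ := pow_le_pow_left₀ (by norm_num) (by linarith) 7
      exact le_of_pow_le_pow_left₀ (by norm_num) (Real.exp_pos _).le h2
    rw [show (-7 / 4 : ℝ) = -(7 / 4) by norm_num, Real.exp_neg]
    have := inv_anti₀ (by norm_num) h4
    linarith
  nlinarith [Real.exp_pos (-s ^ 2 / 2 - 2 * s)]

/-- The Chernoff bound for the lower tail. -/
lemma measureReal_le_of_mgf {Ω : Type*} [MeasurableSpace Ω] {P : Measure Ω}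
    [IsProbabilityMeasure P] {Y : Ω → ℝ} {r u c : ℝ} (hr : 0 ≤ r)
    (hint : Integrable (fun x => Real.exp (-r * Y x)) P)
    (hup : ∫ x, Real.exp (-r * Y x) ∂P ≤ Real.exp c) :
    P.real {x | Y x ≤ u} ≤ Real.exp (c + r * u) := by
  have := measure_le_le_exp_mul_mgf (μ := P) (X := Y) u (neg_nonpos.2 hr) hint
  refine this.trans ?_
  rw [add_comm, Real.exp_add, neg_neg]
  exact mul_le_mul_of_nonneg_left hup (Real.exp_pos _).le

/-- Taylor remainder |a|³/(1 - |a|) of the logarithm, with 1 - |a| ≥ 1/2. -/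
lemma abs_neg_log_one_sub_sub_le {a : ℝ} (ha : |a| ≤ 1 / 2) :
    |-Real.log (1 - a) - a - a ^ 2 / 2| ≤ 2 * |a| ^ 3 := by
  have h := Real.abs_log_sub_add_sum_range_le (x := a) (by linarith) 2
  have e : |-Real.log (1 - a) - a - a ^ 2 / 2| =
      |∑ i ∈ Finset.range 2, a ^ (i + 1) / ((i : ℝ) + 1) + Real.log (1 - a)| := by
    rw [← abs_neg]
    congr 1
    simp [Finset.sum_range_succ]
    ring
  rw [e]
  refine h.trans ?_
  rw [div_le_iff₀ (by linarith)]
  have := pow_nonneg (abs_nonneg a) 3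
  norm_num
  nlinarith

lemma dispersion_pos {w : ℝ} (hw : 0 < w) : 0 < dispersion w := by
  unfold dispersion; positivity

/-- A second order expansion of the cumulant generating function of the information density. -/
lemma abs_infoCgf_sub_le {n : ℕ} {w E s : ℝ} (hw : 0 < w) (hE : 0 ≤ E) (hs : |s| ≤ 1 / 2) :
    |infoCgf n w E s - (n * dispersion w * s ^ 2 / 2 + s ^ 2 * (E - n * w) / (1 + w) ^ 2)| ≤
      2 * |s| ^ 3 * (n + E) := by
  have hw1 : 0 < 1 + w := by positivity
  obtain ⟨a, ha⟩ : ∃ a, a = s * w / (1 + w) := ⟨_, rfl⟩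
  have has : |a| ≤ |s| := by
    rw [ha, mul_div_assoc, abs_mul, abs_of_nonneg (by positivity : 0 ≤ w / (1 + w))]
    exact mul_le_of_le_one_right (abs_nonneg _) (by rw [div_le_one hw1]; linarith)
  have ha2 : |a| ≤ 1 / 2 := has.trans hs
  have ha3 : (1 : ℝ) / 2 ≤ 1 - a := by have := (abs_le.1 ha2).2; linarith
  have h1 : |(n : ℝ) * (-Real.log (1 - a) - a - a ^ 2 / 2)| ≤ 2 * |s| ^ 3 * n := by
    rw [abs_mul, Nat.abs_cast, mul_comm]
    refine mul_le_mul_of_nonneg_right ((abs_neg_log_one_sub_sub_le ha2).trans ?_) (by positivity)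
    gcongr
  have h2 : |s ^ 2 * E / (1 + w) ^ 2 * (a / (1 - a))| ≤ 2 * |s| ^ 3 * E := by
    rw [abs_mul, abs_of_nonneg (by positivity : 0 ≤ s ^ 2 * E / (1 + w) ^ 2), abs_div,
      abs_of_pos (by linarith : 0 < 1 - a)]
    have h3 : |a| / (1 - a) ≤ 2 * |s| := by
      rw [div_le_iff₀ (by linarith)]
      nlinarith [abs_nonneg s]
    have h4 : s ^ 2 * E / (1 + w) ^ 2 ≤ |s| ^ 2 * E := by
      rw [sq_abs]
      exact div_le_self (by positivity) (by nlinarith)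
    calc _ ≤ (|s| ^ 2 * E) * (2 * |s|) :=
          mul_le_mul h4 h3 (div_nonneg (abs_nonneg _) (by linarith)) (by positivity)
      _ = _ := by ring
  -- At E = nw the quadratic terms combine to the dispersion, since w²/2 + w = w(w+2)/2. The two
  -- errors are the logarithmic remainder and the excess of 1/(1-a) = 1 + a/(1-a) over 1.
  have e : infoCgf n w E s - (n * dispersion w * s ^ 2 / 2 + s ^ 2 * (E - n * w) / (1 + w) ^ 2) =
      (n : ℝ) * (-Real.log (1 - a) - a - a ^ 2 / 2) + s ^ 2 * E / (1 + w) ^ 2 * (a / (1 - a)) := by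
    rw [infoCgf, ← ha, dispersion]
    have hn : 1 - a ≠ 0 := by linarith
    have e1 : a ^ 2 = s ^ 2 * w ^ 2 / (1 + w) ^ 2 := by
      rw [ha, div_pow, mul_pow]
    rw [e1]
    have hw2 : w + 1 ≠ 0 := by positivity
    have e2 : s ^ 2 * E / ((1 + w) ^ 2 * (1 - a)) =
        s ^ 2 * E / (1 + w) ^ 2 + s ^ 2 * E / (1 + w) ^ 2 * (a / (1 - a)) := by
      field_simp; ring
    rw [e2]
    field_simp
    ring
  rw [e]
  exact (abs_add_le _ _).trans (by linarith)

/-- For s = r/√(nV) with |r| ≤ √(ln n) + 2, the cubic remainder n|s|³ has this order. So has s²|E -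
nw| when the energy offset is of order √n(√(ln n) + 2). -/
lemma tendsto_sqrt_log_add_two_pow_div :
    Tendsto (fun n : ℕ => (√(Real.log n) + 2) ^ 3 / √(n : ℝ)) atTop (𝓝 0) := by
  have h1 : Tendsto (fun x : ℝ => (√(Real.log x) + 2) ^ 3 / √x) atTop (𝓝 0) := by
    have hlog : (fun x : ℝ => Real.log x ^ (3 : ℝ)) =o[atTop] fun x => x ^ (1 / 2 : ℝ) :=
      isLittleO_log_rpow_rpow_atTop 3 (by norm_num)
    have h2 := hlog.tendsto_div_nhds_zero.const_mul 27
    rw [mul_zero] at h2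
    refine squeeze_zero' (Eventually.of_forall fun x => by positivity) ?_ h2
    filter_upwards [eventually_ge_atTop (Real.exp 1)] with x hx
    have hl : 1 ≤ Real.log x := by
      rw [Real.le_log_iff_exp_le (lt_of_lt_of_le (Real.exp_pos 1) hx)]; exact hx
    rw [← Real.sqrt_eq_rpow, ← mul_div_assoc]
    gcongr
    have h3 : √(Real.log x) ≤ Real.log x := by
      rw [Real.sqrt_le_left (by linarith)]; nlinarith
    calc (√(Real.log x) + 2) ^ 3 ≤ (3 * Real.log x) ^ 3 := by
          gcongr; linarith
      _ = 27 * Real.log x ^ (3 : ℝ) := by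
          rw [show (3 : ℝ) = ((3 : ℕ) : ℝ) by norm_num, Real.rpow_natCast]; ring
  exact h1.comp tendsto_natCast_atTop_atTop

/-- Gaussian estimates of the moment generating function of the normalized information density, for
inputs whose energy is close to the design value. -/
lemma eventually_mgf_infoDensity {w : ℝ} (hw : 0 < w) (A : ℝ) (hA : 0 ≤ A) :
    ∀ᶠ n : ℕ in atTop, ∀ r : ℝ, |r| ≤ √(Real.log n) + 2 → ∀ x : Fin n → ℂ,
      energy x ≤ n * w + A * (√n * (√(Real.log n) + 2)) →
      Integrable (fun z => Real.exp (-r * ((infoDensity w x z - infoMean n w (energy x)) /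
        (√n * √(dispersion w))))) (noise n) ∧
      ∫ z, Real.exp (-r * ((infoDensity w x z - infoMean n w (energy x)) /
        (√n * √(dispersion w)))) ∂noise n ≤ Real.exp (r ^ 2 / 2 + 1 / 4) ∧
      (n * w - A * (√n * (√(Real.log n) + 2)) ≤ energy x →
        Real.exp (r ^ 2 / 2 - 1 / 4) ≤
        ∫ z, Real.exp (-r * ((infoDensity w x z - infoMean n w (energy x)) /
        (√n * √(dispersion w)))) ∂noise n) := by
  obtain ⟨σ, hσ⟩ : ∃ σ, σ = √(dispersion w) := ⟨_, rfl⟩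
  have hσ0 : 0 < σ := by rw [hσ]; exact Real.sqrt_pos.2 (dispersion_pos hw)
  have hσ2 : σ ^ 2 = dispersion w := by rw [hσ]; exact Real.sq_sqrt (dispersion_pos hw).le
  rw [← hσ]
  have hκ : ∀ c : ℝ, 0 < c → ∀ᶠ n : ℕ in atTop, (√(Real.log n) + 2) ^ 3 / √(n : ℝ) ≤ c :=
    fun c hc => tendsto_sqrt_log_add_two_pow_div.eventually_le_const hc
  have hB : 0 < 2 * (2 + w) / σ ^ 3 + A / σ ^ 2 := by positivity
  -- The three smallness conditions give, in order, |s| ≤ 1/2, energy at most n(w+1), and a total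
  -- cumulant error of at most 1/4.
  filter_upwards [hκ (σ / 2) (by positivity), hκ (1 / (A + 1)) (by positivity),
    hκ (1 / 4 / (2 * (2 + w) / σ ^ 3 + A / σ ^ 2)) (by positivity),
    eventually_gt_atTop 0] with n h1 h2 h3 hn r hr x hx
  obtain ⟨U, hU⟩ : ∃ U, U = √(Real.log n) + 2 := ⟨_, rfl⟩
  have hU2 : 2 ≤ U := by rw [hU]; have := Real.sqrt_nonneg (Real.log n); linarith
  have hn0 : (0 : ℝ) < n := by exact_mod_cast hn
  obtain ⟨t, ht⟩ : ∃ t, t = √(n : ℝ) := ⟨_, rfl⟩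
  have ht0 : 0 < t := by rw [ht]; exact Real.sqrt_pos.2 hn0
  have hnt : (n : ℝ) = t ^ 2 := by rw [ht, Real.sq_sqrt hn0.le]
  simp only [← ht, ← hU] at h1 h2 h3 hr hx ⊢
  have hUU : U ≤ U ^ 3 := by nlinarith [mul_nonneg (by linarith : 0 ≤ U) (by nlinarith : 0 ≤ U ^ 2 - 1)]
  obtain ⟨s, hs⟩ : ∃ s, s = r / (t * σ) := ⟨_, rfl⟩
  have hsU : |s| ≤ U / (t * σ) := by
    rw [hs, abs_div, abs_of_pos (by positivity : 0 < t * σ)]; gcongr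
  have hs2 : |s| ≤ 1 / 2 := by
    refine hsU.trans ?_
    rw [div_le_iff₀ (by positivity)]
    rw [div_le_iff₀ ht0] at h1
    nlinarith
  have hE := energy_nonneg x
  have hsw : s * w / (1 + w) < 1 := by
    rw [div_lt_one (by positivity)]
    have := (abs_le.1 hs2).2
    nlinarith
  have heq : ∀ z, -r * ((infoDensity w x z - infoMean n w (energy x)) / (t * σ)) =
      -s * (infoDensity w x z - infoMean n w (energy x)) := by
    intro z; rw [hs]; ring
  simp_rw [heq]
  rw [integral_exp_infoDensity hw hsw x]
  refine ⟨integrable_exp_infoDensity hw hsw x, ?_⟩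
  have hc := abs_le.1 (abs_infoCgf_sub_le (n := n) hw hE hs2)
  have hr2 : (n : ℝ) * dispersion w * s ^ 2 / 2 = r ^ 2 / 2 := by
    rw [hs, ← hσ2, hnt]; field_simp
  rw [hr2] at hc
  have hEup : energy x ≤ t ^ 2 * (w + 1) := by
    have : A * U ≤ t := by
      rw [div_le_div_iff₀ ht0 (by positivity)] at h2
      nlinarith
    rw [hnt] at hx
    nlinarith
  have hrem1 : 2 * |s| ^ 3 * (n + energy x) ≤ 2 * (2 + w) / σ ^ 3 * (U ^ 3 / t) := by
    calc 2 * |s| ^ 3 * (n + energy x) ≤ 2 * (U / (t * σ)) ^ 3 * (t ^ 2 + t ^ 2 * (w + 1)) := by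
          rw [hnt]; gcongr
      _ = _ := by field_simp; ring
  have hs2' : s ^ 2 / (1 + w) ^ 2 ≤ (U / (t * σ)) ^ 2 := by
    calc s ^ 2 / (1 + w) ^ 2 ≤ s ^ 2 := div_le_self (sq_nonneg _) (by nlinarith)
      _ = |s| ^ 2 := (sq_abs s).symm
      _ ≤ _ := by gcongr
  have hs2'' : s ^ 2 / (1 + w) ^ 2 * (A * (t * U)) ≤ A / σ ^ 2 * (U ^ 3 / t) := by
    calc _ ≤ (U / (t * σ)) ^ 2 * (A * (t * U)) := by gcongr
      _ = _ := by field_simp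
  have hsum : 2 * (2 + w) / σ ^ 3 * (U ^ 3 / t) + A / σ ^ 2 * (U ^ 3 / t) ≤ 1 / 4 := by
    rw [← add_mul, mul_comm]
    rwa [le_div_iff₀ hB] at h3
  have hs0 : 0 ≤ s ^ 2 / (1 + w) ^ 2 := by positivity
  rw [mul_div_right_comm] at hc
  refine ⟨Real.exp_le_exp.2 ?_, fun hx' => Real.exp_le_exp.2 ?_⟩
  · have := mul_le_mul_of_nonneg_left (by linarith : energy x - n * w ≤ A * (t * U)) hs0
    linarith [hc.2]
  · have := mul_le_mul_of_nonneg_left (by linarith : -(A * (t * U)) ≤ energy x - n * w) hs0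
    linarith [hc.1]

/-- Explains the √(ln n) of the expansion: a deviation of √(ln n) standard deviations has Gaussian
weight exactly 1/√n. -/
lemma exp_neg_half_log {n : ℕ} (hn : 0 < n) :
    Real.exp (-(√(Real.log n)) ^ 2 / 2) = 1 / √(n : ℝ) := by
  have hn0 : (1 : ℝ) ≤ n := by exact_mod_cast hn
  rw [Real.sq_sqrt (Real.log_nonneg hn0), neg_div, Real.exp_neg, one_div, Real.exp_half,
    Real.exp_log (by linarith)]

lemma exp_quarter_le_two : Real.exp (1 / 4) ≤ 2 := by
  have := Real.add_one_le_exp (-(1 / 4) : ℝ)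
  rw [Real.exp_neg] at this
  have h := Real.exp_pos (1 / 4)
  have h2 : (1 / 2 : ℝ) ≤ (Real.exp (1 / 4))⁻¹ := by linarith
  rw [le_inv_comm₀ (by norm_num) h] at h2
  linarith

/-! ### Moderate deviations and the information spectrum -/

/-- Moderate deviations: upper bound for the lower tail of the information density. -/
lemma eventually_infoDensity_lower_tail_le {w : ℝ} (hw : 0 < w) (A : ℝ) (hA : 0 ≤ A) :
    ∀ᶠ n : ℕ in atTop, ∀ x : Fin n → ℂ,
      energy x ≤ n * w + A * (√n * (√(Real.log n) + 2)) →
      (noise n).real {z | infoDensity w x z ≤ infoMean n w (energy x) -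
        √n * √(dispersion w) * √(Real.log n)} ≤ 2 / √n := by
  filter_upwards [eventually_mgf_infoDensity hw A hA, eventually_gt_atTop 0] with n h hn x hx
  have hn0 : (0 : ℝ) < n := by exact_mod_cast hn
  have hS : 0 < √(n : ℝ) * √(dispersion w) :=
    mul_pos (Real.sqrt_pos.2 hn0) (Real.sqrt_pos.2 (dispersion_pos hw))
  obtain ⟨hi, hup, -⟩ := h (√(Real.log n)) (by rw [abs_of_nonneg (Real.sqrt_nonneg _)]; linarith)
    x hx
  have := measureReal_le_of_mgf (u := -√(Real.log n)) (Real.sqrt_nonneg _) hi hup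
  have hset : {z | infoDensity w x z ≤ infoMean n w (energy x) -
      √n * √(dispersion w) * √(Real.log n)} = {z | (infoDensity w x z - infoMean n w (energy x)) /
        (√n * √(dispersion w)) ≤ -√(Real.log n)} := by
    ext z
    simp only [Set.mem_ofPred_eq]
    rw [div_le_iff₀ hS]
    constructor <;> intro h <;> linarith
  rw [hset]
  refine this.trans ?_
  rw [show √(Real.log n) ^ 2 / 2 + 1 / 4 + √(Real.log n) * -√(Real.log n) =
    -(√(Real.log n)) ^ 2 / 2 + 1 / 4 by ring, Real.exp_add, exp_neg_half_log hn, div_mul_eq_mul_div,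
    one_mul]
  gcongr
  exact exp_quarter_le_two

/-- Moderate deviations: upper bound for the upper tail of the information density. -/
lemma eventually_infoDensity_upper_tail_le {w : ℝ} (hw : 0 < w) :
    ∀ᶠ n : ℕ in atTop, ∀ x : Fin n → ℂ, energy x ≤ n * w →
      (noise n).real {z | infoMean n w (energy x) + √n * √(dispersion w) * √(Real.log n) ≤
        infoDensity w x z} ≤ 2 / √n := by
  filter_upwards [eventually_mgf_infoDensity hw 0 le_rfl, eventually_gt_atTop 0] with n h hn x hx
  have hn0 : (0 : ℝ) < n := by exact_mod_cast hn
  have hS : 0 < √(n : ℝ) * √(dispersion w) :=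
    mul_pos (Real.sqrt_pos.2 hn0) (Real.sqrt_pos.2 (dispersion_pos hw))
  obtain ⟨hi, hup, -⟩ := h (-√(Real.log n))
    (by rw [abs_neg, abs_of_nonneg (Real.sqrt_nonneg _)]; linarith) x (by linarith)
  simp_rw [neg_mul_comm (-√(Real.log n))] at hi hup
  have := measureReal_le_of_mgf (u := -√(Real.log n)) (Real.sqrt_nonneg _) hi hup
  have hset : {z | infoMean n w (energy x) + √n * √(dispersion w) * √(Real.log n) ≤
      infoDensity w x z} = {z | -((infoDensity w x z - infoMean n w (energy x)) /
        (√n * √(dispersion w))) ≤ -√(Real.log n)} := by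
    ext z
    simp only [Set.mem_ofPred_eq]
    rw [neg_le_neg_iff, le_div_iff₀ hS]
    constructor <;> intro h <;> linarith
  rw [hset]
  refine this.trans ?_
  rw [show (-√(Real.log n)) ^ 2 / 2 + 1 / 4 + √(Real.log n) * -√(Real.log n) =
    -(√(Real.log n)) ^ 2 / 2 + 1 / 4 by ring, Real.exp_add, exp_neg_half_log hn, div_mul_eq_mul_div,
    one_mul]
  gcongr
  exact exp_quarter_le_two

lemma tendsto_sqrt_log_atTop : Tendsto (fun n : ℕ => √(Real.log n)) atTop atTop :=
  Real.tendsto_sqrt_atTop.comp (Real.tendsto_log_atTop.comp tendsto_natCast_atTop_atTop)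

/-- Moderate deviations: lower bound for the lower tail of the information density. -/
lemma eventually_le_infoDensity_lower_tail {w : ℝ} (hw : 0 < w) (A : ℝ) (hA : 0 ≤ A) :
    ∀ᶠ n : ℕ in atTop, ∀ x : Fin n → ℂ,
      energy x ≤ n * w + A * (√n * (√(Real.log n) + 2)) →
      n * w - A * (√n * (√(Real.log n) + 2)) ≤ energy x →
      1 / 4 * Real.exp (2 * √(Real.log n)) / √n ≤
      (noise n).real {z | infoDensity w x z ≤ infoMean n w (energy x) +
        √n * √(dispersion w) * (6 - √(Real.log n))} := by
  filter_upwards [eventually_mgf_infoDensity hw A hA, eventually_gt_atTop 0,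
    tendsto_sqrt_log_atTop.eventually_ge_atTop 4] with n h hn h4 x hx hx'
  have hn0 : (0 : ℝ) < n := by exact_mod_cast hn
  have hS : 0 < √(n : ℝ) * √(dispersion w) :=
    mul_pos (Real.sqrt_pos.2 hn0) (Real.sqrt_pos.2 (dispersion_pos hw))
  have hr : ∀ r, |r - (√(Real.log n) - 4)| ≤ 2 → |r| ≤ √(Real.log n) + 2 := by
    intro r hr
    rw [abs_le] at hr ⊢
    constructor <;> linarith
  -- The tilt s = √(ln n) - 4 places the right end of the window at 6 - √(ln n). Backing off by 4
  -- gains a factor exp(2√(ln n)) over 1/√n, the surplus that the spectrum bound needs.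
  have := le_measureReal_window (P := noise n) (Y := fun z => (infoDensity w x z -
      infoMean n w (energy x)) / (√n * √(dispersion w))) (by fun_prop)
    (s := √(Real.log n) - 4) (by linarith) (fun r hr' => (h r (hr r hr') x hx).1)
    ((h _ (hr _ (by simp)) x hx).2.2 hx') (fun r hr' => (h r (hr r hr') x hx).2.1)
  refine le_trans (le_of_eq ?_) (this.trans (measureReal_mono ?_))
  · rw [show -(√(Real.log n) - 4) ^ 2 / 2 - 2 * (√(Real.log n) - 4) =
      2 * √(Real.log n) + -(√(Real.log n)) ^ 2 / 2 by ring, Real.exp_add, exp_neg_half_log hn]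
    ring
  · intro z hz
    have hz2 := hz.2
    rw [div_le_iff₀ hS] at hz2
    show infoDensity w x z ≤ _
    linarith

/-- The information density spectrum, uniformly in the input: the probability that the information
density exceeds a suitable threshold is essentially linear in the energy. -/
lemma eventually_infoDensity_spectrum_le {w : ℝ} (hw : 0 < w) (K : ℝ) (hK : 0 ≤ K) :
    ∀ᶠ n : ℕ in atTop, ∀ x : Fin n → ℂ,
      (noise n).real {z | n * Real.log (1 + w) - √n * √(dispersion w) * √(Real.log n) +
        (6 * √(dispersion w) + K / (1 + w)) * √n < infoDensity w x z} ≤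
      energy x / (n * (w + K / √n)) + 2 / √n := by
  obtain ⟨σ, hσ⟩ : ∃ σ, σ = √(dispersion w) := ⟨_, rfl⟩
  have hσ0 : 0 < σ := by rw [hσ]; exact Real.sqrt_pos.2 (dispersion_pos hw)
  -- An energy deficit A√(n ln n) lowers the mean by 2σ√(n ln n), leaving the threshold at least
  -- σ√(n ln n) above it.
  obtain ⟨A, hA⟩ : ∃ A, A = 2 * σ * (1 + w) := ⟨_, rfl⟩
  have hA0 : 0 ≤ A := by rw [hA]; positivity
  have hbig : ∀ᶠ n : ℕ in atTop, (A * √(Real.log n) + K) / w ≤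
      1 / 4 * Real.exp (2 * √(Real.log n)) := by
    have : ∀ᶠ u : ℝ in atTop, (A * u + K) / w ≤ 1 / 4 * Real.exp (2 * u) := by
      filter_upwards [eventually_ge_atTop (4 * (A + K) / w), eventually_ge_atTop 1] with u h1 h2
      have h3 : u ^ 2 ≤ Real.exp (2 * u) := by
        rw [two_mul, Real.exp_add, sq]
        have := Real.add_one_le_exp u
        gcongr <;> linarith
      rw [div_le_iff₀ hw] at h1 ⊢
      nlinarith
    exact tendsto_sqrt_log_atTop.eventually this
  rw [← hσ]
  filter_upwards [eventually_le_infoDensity_lower_tail hw (A + K) (by positivity),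
    eventually_infoDensity_upper_tail_le hw, hbig, eventually_gt_atTop 0] with n hlow hup hb hn x
  rw [← hσ] at hlow hup
  have hn0 : (0 : ℝ) < n := by exact_mod_cast hn
  obtain ⟨t, ht⟩ : ∃ t, t = √(n : ℝ) := ⟨_, rfl⟩
  have ht0 : 0 < t := by rw [ht]; exact Real.sqrt_pos.2 hn0
  have hnt : (n : ℝ) = t ^ 2 := by rw [ht, Real.sq_sqrt hn0.le]
  obtain ⟨u, hu⟩ : ∃ u, u = √(Real.log n) := ⟨_, rfl⟩
  have hu0 : 0 ≤ u := by rw [hu]; positivity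
  have hE := energy_nonneg x
  specialize hlow x
  specialize hup x
  simp only [← ht, ← hu] at hlow hup hb ⊢
  have hw1 : 0 < 1 + w := by positivity
  have hden : 0 < n * (w + K / t) := by positivity
  have hden' : n * (w + K / t) = n * w + K * t := by rw [hnt]; field_simp
  have hE1 : 0 ≤ energy x / (n * (w + K / t)) := by positivity
  have h2t : 0 ≤ 2 / t := by positivity
  -- Three energy ranges. At high energy the affine bound exceeds 1. At low energy the threshold
  -- lies in the upper tail, of mass at most 2/√n. In between, the relative deficit of energy is at
  -- most (A√(ln n) + K)/(w√n), and the lower tail, of order exp(2√(ln n))/√n, outweighs it.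
  rcases le_total (n * (w + K / t)) (energy x) with h | h
  · have : 1 ≤ energy x / (n * (w + K / t)) := by rwa [one_le_div hden]
    have := measureReal_le_one (μ := noise n) (s := {z | n * Real.log (1 + w) - t * σ * u +
        (6 * σ + K / (1 + w)) * t < infoDensity w x z})
    linarith
  rcases le_total (energy x) (n * w - A * (t * u)) with h' | h'
  · have hmono : (noise n).real {z | n * Real.log (1 + w) - t * σ * u +
        (6 * σ + K / (1 + w)) * t < infoDensity w x z} ≤
        (noise n).real {z | infoMean n w (energy x) + t * σ * u ≤ infoDensity w x z} := by
      refine measureReal_mono fun z hz => ?_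
      refine le_trans (b := n * Real.log (1 + w) - t * σ * u + (6 * σ + K / (1 + w)) * t) ?_
        (le_of_lt hz)
      have h3 : (energy x - n * w) / (1 + w) ≤ -(2 * σ * (t * u)) := by
        rw [div_le_iff₀ hw1]
        rw [hA] at h'
        linarith
      have h4 : 0 ≤ (6 * σ + K / (1 + w)) * t := by positivity
      rw [infoMean]
      linarith
    have := hup (h'.trans (by have : 0 ≤ A * (t * u) := by positivity
                              linarith))
    linarith
  · have hKu : K * t ≤ (A + K) * (t * (u + 2)) := by
      have : 0 ≤ A * (t * (u + 2)) := by positivity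
      have : 0 ≤ K * (t * (u + 1)) := by positivity
      linarith
    have hAu : A * (t * u) ≤ (A + K) * (t * (u + 2)) := by
      have : 0 ≤ A * (t * 2) := by positivity
      have : 0 ≤ K * (t * (u + 2)) := by positivity
      linarith
    have hl := hlow (by linarith) (by linarith)
    have hmeas : MeasurableSet {z | infoDensity w x z ≤ n * Real.log (1 + w) - t * σ * u +
        (6 * σ + K / (1 + w)) * t} := measurableSet_le (by fun_prop) measurable_const
    have hmono : (noise n).real {z | infoDensity w x z ≤ infoMean n w (energy x) +
        t * σ * (6 - u)} ≤ (noise n).real {z | infoDensity w x z ≤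
          n * Real.log (1 + w) - t * σ * u + (6 * σ + K / (1 + w)) * t} := by
      refine measureReal_mono fun z hz => ?_
      refine le_trans (b := infoMean n w (energy x) + t * σ * (6 - u)) hz ?_
      have h3 : (energy x - n * w) / (1 + w) ≤ K / (1 + w) * t := by
        rw [div_mul_eq_mul_div, div_le_div_iff_of_pos_right hw1]
        linarith
      rw [infoMean]
      linarith
    have hcompl := probReal_compl_eq_one_sub (μ := noise n) hmeas
    have hset : {z | infoDensity w x z ≤ n * Real.log (1 + w) - t * σ * u +
        (6 * σ + K / (1 + w)) * t}ᶜ = {z | n * Real.log (1 + w) - t * σ * u +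
        (6 * σ + K / (1 + w)) * t < infoDensity w x z} := by
      ext z; simp
    rw [hset] at hcompl
    rw [hcompl]
    have hfin : 1 - energy x / (n * (w + K / t)) ≤ 1 / 4 * Real.exp (2 * u) / t := by
      have e : 1 - energy x / (n * (w + K / t)) =
          (n * (w + K / t) - energy x) / (n * (w + K / t)) := by field_simp
      rw [e]
      calc _ ≤ (A * (t * u) + K * t) / (n * w) := by
            refine div_le_div₀ (by positivity) (by linarith) (by positivity) ?_
            rw [hden']
            have : 0 ≤ K * t := by positivity
            linarith
        _ = (A * u + K) / w / t := by rw [hnt]; field_simp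
        _ ≤ _ := by gcongr
    linarith

/-- For inputs of bounded energy, the information density is bounded in probability. -/
lemma exists_infoDensity_tail_le {n : ℕ} {w : ℝ} (hw : 0 < w) (E₀ : ℝ) {b : ℝ} (hb : 0 < b) :
    ∃ T : ℝ, ∀ x : Fin n → ℂ, energy x ≤ E₀ →
      (noise n).real {z | T < infoDensity w x z} ≤ b := by
  obtain ⟨c, hc⟩ : ∃ c, c = n * dispersion w + |E₀| + n + |E₀| := ⟨_, rfl⟩
  obtain ⟨m, hm⟩ : ∃ m, m = n * Real.log (1 + w) + |E₀| := ⟨_, rfl⟩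
  refine ⟨m + 2 * (c - Real.log b), fun x hx => ?_⟩
  have hw1 : 0 < 1 + w := by positivity
  have hV := dispersion_pos hw
  have hE := energy_nonneg x
  have hE0 := hx.trans (le_abs_self E₀)
  have hsw : (-(1 / 2)) * w / (1 + w) < 1 := by
    rw [div_lt_one hw1]; linarith
  have hi := integrable_exp_infoDensity hw hsw x
  have hI := (integral_exp_infoDensity hw hsw x).le
  -- Chernoff bound with tilt 1/2 on the upper tail; the 2 in the threshold is the inverse of this
  -- tilt, so that the exponent comes out as ln b.
  simp_rw [neg_mul_comm (-(1 / 2) : ℝ)] at hi hI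
  have := measureReal_le_of_mgf (u := -(2 * (c - Real.log b))) (by norm_num) hi hI
  have hmean : infoMean n w (energy x) ≤ m := by
    rw [infoMean, hm]
    have : (energy x - n * w) / (1 + w) ≤ energy x := by
      rw [div_le_iff₀ hw1]
      have : 0 ≤ n * w := by positivity
      nlinarith
    linarith
  have hcgf : infoCgf n w (energy x) (-(1 / 2)) ≤ c := by
    have h := (abs_le.1 (abs_infoCgf_sub_le (n := n) (s := -(1 / 2)) hw hE (by norm_num))).2
    have h2 : (-(1 / 2) : ℝ) ^ 2 * (energy x - n * w) / (1 + w) ^ 2 ≤ energy x := by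
      rw [div_le_iff₀ (by positivity)]
      have h3 : 0 ≤ (n : ℝ) * w := by positivity
      nlinarith [mul_nonneg hE hw.le, mul_nonneg hE (sq_nonneg w)]
    have h3 : |(-(1 / 2) : ℝ)| = 1 / 2 := by norm_num
    rw [h3] at h
    have h4 : 0 ≤ (n : ℝ) * dispersion w := by positivity
    rw [hc]
    nlinarith
  refine le_trans (measureReal_mono ?_) (this.trans ?_)
  · intro z hz
    have hz' : m + 2 * (c - Real.log b) < infoDensity w x z := hz
    show -(infoDensity w x z - _) ≤ _
    linarith
  · rw [← Real.log_le_log_iff (Real.exp_pos _) hb, Real.log_exp]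
    linarith

/-! ### Energy of a Gaussian input -/

lemma integral_exp_energy {n : ℕ} {w s : ℝ} (hw : 0 < w) (hs : 0 < 1 + s * w) :
    Integrable (fun x : Fin n → ℂ => Real.exp (-s * (energy x - n * w))) (gaussVec w 0) ∧
    ∫ x : Fin n → ℂ, Real.exp (-s * (energy x - n * w)) ∂gaussVec w 0 =
      Real.exp (n * (s * w - Real.log (1 + s * w))) := by
  have hb : 0 < (1 + s * w) / w := by positivity
  have h : ∀ x : Fin n → ℂ, gaussDensity w 0 x * Real.exp (-s * (energy x - n * w)) =
      ((Real.pi * w)⁻¹ ^ n * Real.exp (n * (s * w))) *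
        Real.exp (-((1 + s * w) / w) * energy (x - 0)) := by
    intro x
    rw [gaussDensity, mul_assoc, mul_assoc, ← Real.exp_add, ← Real.exp_add, sub_zero]
    congr 2
    field_simp
    ring
  rw [integrable_gaussVec_iff hw, integral_gaussVec hw]
  simp_rw [h]
  refine ⟨(integrable_exp_neg_mul_energy hb _).const_mul _, ?_⟩
  rw [integral_const_mul, integral_exp_neg_mul_energy hb, mul_right_comm, ← mul_pow, mul_sub,
    sub_eq_add_neg, Real.exp_add, mul_comm,
    show -((n : ℝ) * Real.log (1 + s * w)) = n * -Real.log (1 + s * w) by ring,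
    Real.exp_nat_mul (-Real.log _), Real.exp_neg, Real.exp_log hs]
  congr 2
  have := Real.pi_pos.ne'
  field_simp

/-- A Gaussian vector has energy slightly below its mean with probability bounded below. -/
lemma eventually_le_gaussVec_shell {w : ℝ} (hw : 0 < w) {c : ℝ} (hc : 0 ≤ c) :
    ∃ p B : ℝ, 0 < p ∧ 0 ≤ B ∧ ∀ᶠ n : ℕ in atTop,
      p ≤ (gaussVec w (0 : Fin n → ℂ)).real
        {x | n * w - B * √n ≤ energy x ∧ energy x ≤ n * w - c * √n} := by
  -- With this tilt the window for (energy - nw)/(w√n) runs from -4 - c/w to -c/w, which is the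
  -- required shell with B = 4w + c. As s does not depend on n, neither does the lower bound for the
  -- probability.
  obtain ⟨s, hs⟩ : ∃ s, s = 2 + c / w := ⟨_, rfl⟩
  have hs0 : 2 ≤ s := by rw [hs]; have : 0 ≤ c / w := by positivity
                         linarith
  refine ⟨1 / 4 * Real.exp (-s ^ 2 / 2 - 2 * s), 4 * w + c, by positivity, by positivity, ?_⟩
  have hsq : Tendsto (fun n : ℕ => √(n : ℝ)) atTop atTop :=
    Real.tendsto_sqrt_atTop.comp tendsto_natCast_atTop_atTop
  filter_upwards [hsq.eventually_ge_atTop (8 * (s + 2) ^ 3), hsq.eventually_ge_atTop (2 * (s + 2)),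
    eventually_gt_atTop 0] with n h1 h2 hn
  have hn0 : (0 : ℝ) < n := by exact_mod_cast hn
  obtain ⟨t, ht⟩ : ∃ t, t = √(n : ℝ) := ⟨_, rfl⟩
  have ht0 : 0 < t := by rw [ht]; exact Real.sqrt_pos.2 hn0
  have hnt : (n : ℝ) = t ^ 2 := by rw [ht, Real.sq_sqrt hn0.le]
  simp only [← ht] at h1 h2 ⊢
  have := isProbabilityMeasure_gaussVec (n := n) hw 0
  have hmgf : ∀ r, |r - s| ≤ 2 →
      Integrable (fun x : Fin n → ℂ => Real.exp (-r * ((energy x - n * w) / (t * w))))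
        (gaussVec w 0) ∧
      |n * (r / (t * w) * w - Real.log (1 + r / (t * w) * w)) - r ^ 2 / 2| ≤ 1 / 4 ∧
      ∫ x : Fin n → ℂ, Real.exp (-r * ((energy x - n * w) / (t * w))) ∂gaussVec w 0 =
        Real.exp (n * (r / (t * w) * w - Real.log (1 + r / (t * w) * w))) := by
    intro r hr
    have hrs : |r| ≤ s + 2 := by
      rw [abs_le] at hr ⊢
      constructor <;> linarith
    have ea : r / (t * w) * w = r / t := by field_simp
    have ha : |-(r / t)| ≤ 1 / 2 := by
      rw [abs_neg, abs_div, abs_of_pos ht0, div_le_iff₀ ht0]; linarith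
    have ha' := abs_le.1 ha
    have hpos : 0 < 1 + r / (t * w) * w := by rw [ea]; linarith
    obtain ⟨hi, hI⟩ := integral_exp_energy (n := n) hw hpos
    have heq : ∀ x : Fin n → ℂ, -r * ((energy x - n * w) / (t * w)) =
        -(r / (t * w)) * (energy x - n * w) := fun x => by ring
    simp_rw [heq]
    refine ⟨hi, ?_, hI⟩
    have hl := abs_neg_log_one_sub_sub_le ha
    rw [ea, show (n : ℝ) * (r / t - Real.log (1 + r / t)) - r ^ 2 / 2 =
      n * (-Real.log (1 - -(r / t)) - -(r / t) - (-(r / t)) ^ 2 / 2) by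
        rw [sub_neg_eq_add, hnt]; field_simp; ring_nf, abs_mul, Nat.abs_cast]
    calc _ ≤ n * (2 * |-(r / t)| ^ 3) := by gcongr
      _ = 2 * |r| ^ 3 / t := by rw [abs_neg, abs_div, abs_of_pos ht0, hnt]; field_simp
      _ ≤ 2 * (s + 2) ^ 3 / t := by gcongr
      _ ≤ 1 / 4 := by rw [div_le_iff₀ ht0]; linarith
  have key := le_measureReal_window (P := gaussVec w (0 : Fin n → ℂ))
    (Y := fun x => (energy x - n * w) / (t * w)) (by fun_prop) (s := s) (by linarith)
    (fun r hr => (hmgf r hr).1)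
    (by
      obtain ⟨-, h, e⟩ := hmgf s (by simp)
      rw [e]
      exact Real.exp_le_exp.2 (by linarith [(abs_le.1 h).1]))
    (fun r hr => by
      obtain ⟨-, h, e⟩ := hmgf r hr
      rw [e]
      exact Real.exp_le_exp.2 (by linarith [(abs_le.1 h).2]))
  refine key.trans (measureReal_mono ?_)
  rintro x ⟨hx1, hx2⟩
  rw [le_div_iff₀ (by positivity)] at hx1
  rw [div_le_iff₀ (by positivity)] at hx2
  have hcw : s * (t * w) = 2 * (t * w) + c * t := by rw [hs]; field_simp
  constructor <;> nlinarith

/-! ### Generalized inverse and the knapsack of transmission probabilities -/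

section

variable {PH : Measure ℂ}

lemma zero_mem_genInv_set {t : ℝ} (ht : 0 ≤ t) :
    (0 : ℝ) ∈ {g : ℝ | PH.real {h | gain h < g} ≤ t} := by
  have : {h | gain h < 0} = ∅ := by
    ext h
    simp [gain_nonneg h]
  simp [this, ht]

variable [IsProbabilityMeasure PH]

lemma measurableSet_gain_lt (g : ℝ) : MeasurableSet {h | gain h < g} :=
  measurableSet_lt measurable_gain measurable_const

lemma measurableSet_gain_le (g : ℝ) : MeasurableSet {h | gain h ≤ g} :=
  measurableSet_le measurable_gain measurable_const

lemma measurableSet_lt_gain (g : ℝ) : MeasurableSet {h | g < gain h} :=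
  measurableSet_lt measurable_const measurable_gain

lemma measurableSet_gain_eq (g : ℝ) : MeasurableSet {h | gain h = g} :=
  measurableSet_eq_fun measurable_gain measurable_const

lemma measure_gain_lt_mono {a b : ℝ} (h : a ≤ b) :
    PH.real {h | gain h < a} ≤ PH.real {h | gain h < b} :=
  measureReal_mono fun _ hx => lt_of_lt_of_le hx h

lemma bddAbove_genInv_set {t : ℝ} (ht : t < 1) :
    BddAbove {g : ℝ | PH.real {h | gain h < g} ≤ t} := by
  have h1 : Tendsto (fun k : ℕ => PH.real {h | gain h < (k : ℝ)}) atTop (𝓝 1) := by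
    have hmono : Monotone fun k : ℕ => {h | gain h < (k : ℝ)} := fun a b hab x hx =>
      lt_of_lt_of_le (show gain x < (a : ℝ) from hx) (Nat.cast_le.2 hab)
    have h2 := tendsto_measure_iUnion_atTop (μ := PH) hmono
    have h3 : ⋃ k : ℕ, {h | gain h < (k : ℝ)} = Set.univ :=
      Set.eq_univ_of_forall fun x => Set.mem_iUnion.2 (exists_nat_gt (gain x))
    rw [h3, measure_univ] at h2
    exact (ENNReal.tendsto_toReal ENNReal.one_ne_top).comp h2
  obtain ⟨k, hk⟩ := (h1.eventually_const_lt ht).exists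
  refine ⟨k, fun g hg => ?_⟩
  by_contra hlt
  exact absurd (measure_gain_lt_mono (PH := PH) (not_le.1 hlt).le) (by
    have : PH.real {h | gain h < g} ≤ t := hg
    linarith)

lemma genInv_mono {s t : ℝ} (hs : 0 ≤ s) (hst : s ≤ t) (ht : t < 1) :
    genInv PH s ≤ genInv PH t :=
  csSup_le_csSup (bddAbove_genInv_set ht) ⟨0, zero_mem_genInv_set hs⟩
    fun _ hg => le_trans (show PH.real _ ≤ s from hg) hst

/-- Continuity of the measure from below. With `le_measure_le_genInv`, which is continuity from
above, it brackets t between the two one-sided values of the distribution function, so that an atom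
at the threshold can be split to give outage exactly t. -/
lemma measure_lt_genInv_le {t : ℝ} (ht0 : 0 ≤ t) :
    PH.real {h | gain h < genInv PH t} ≤ t := by
  have hmono : Monotone fun k : ℕ => {h | gain h < genInv PH t - 1 / ((k : ℝ) + 1)} :=
    fun a b hab x hx => lt_of_lt_of_le (show gain x < _ from hx)
      (sub_le_sub_left (Nat.one_div_le_one_div hab) _)
  have h2 := tendsto_measure_iUnion_atTop (μ := PH) hmono
  have h3 : ⋃ k : ℕ, {h | gain h < genInv PH t - 1 / ((k : ℝ) + 1)} =
      {h | gain h < genInv PH t} := by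
    ext x
    simp only [Set.mem_iUnion, Set.mem_ofPred_eq]
    constructor
    · rintro ⟨k, hk⟩
      have : (0 : ℝ) < 1 / ((k : ℝ) + 1) := by positivity
      linarith
    · intro hx
      obtain ⟨k, hk⟩ := exists_nat_one_div_lt (sub_pos.2 hx)
      exact ⟨k, by linarith⟩
  rw [h3] at h2
  refine le_of_tendsto ((ENNReal.tendsto_toReal (measure_ne_top _ _)).comp h2)
    (Eventually.of_forall fun k => ?_)
  have hk : (0 : ℝ) < 1 / ((k : ℝ) + 1) := by positivity
  obtain ⟨g, hg, hlt⟩ := exists_lt_of_lt_csSup (s := {g : ℝ | PH.real {h | gain h < g} ≤ t})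
    ⟨0, zero_mem_genInv_set ht0⟩
    (show genInv PH t - 1 / ((k : ℝ) + 1) < sSup _ from by rw [← genInv]; linarith)
  exact (measure_gain_lt_mono hlt.le).trans hg

lemma le_measure_le_genInv {t : ℝ} (ht1 : t < 1) :
    t ≤ PH.real {h | gain h ≤ genInv PH t} := by
  have hmono : Antitone fun k : ℕ => {h | gain h < genInv PH t + 1 / ((k : ℝ) + 1)} :=
    fun a b hab x hx => lt_of_lt_of_le (show gain x < _ from hx)
      (add_le_add_right (Nat.one_div_le_one_div hab) _)
  have h2 := tendsto_measure_iInter_atTop (μ := PH)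
    (fun k : ℕ => (measurableSet_gain_lt (genInv PH t + 1 / ((k : ℝ) + 1))).nullMeasurableSet)
    hmono ⟨0, measure_ne_top _ _⟩
  have h3 : ⋂ k : ℕ, {h | gain h < genInv PH t + 1 / ((k : ℝ) + 1)} =
      {h | gain h ≤ genInv PH t} := by
    ext x
    simp only [Set.mem_iInter, Set.mem_ofPred_eq]
    constructor
    · intro hx
      by_contra hlt
      obtain ⟨k, hk⟩ := exists_nat_one_div_lt (sub_pos.2 (not_le.1 hlt))
      have := hx k
      linarith
    · intro hx k
      have : (0 : ℝ) < 1 / ((k : ℝ) + 1) := by positivity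
      linarith
  rw [h3] at h2
  refine ge_of_tendsto ((ENNReal.tendsto_toReal (measure_ne_top _ _)).comp h2)
    (Eventually.of_forall fun k => ?_)
  have hk : (0 : ℝ) < 1 / ((k : ℝ) + 1) := by positivity
  by_contra hlt
  have := le_csSup (bddAbove_genInv_set (PH := PH) ht1)
    (show genInv PH t + 1 / ((k : ℝ) + 1) ∈ {g : ℝ | PH.real {h | gain h < g} ≤ t} from
      (not_le.1 hlt).le)
  rw [← genInv] at this
  linarith

lemma measure_gain_le_eq (g : ℝ) :
    PH.real {h | gain h ≤ g} = PH.real {h | gain h < g} + PH.real {h | gain h = g} := by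
  rw [← measureReal_union _ (measurableSet_gain_eq g)]
  · congr 1
    ext x
    exact le_iff_lt_or_eq (a := gain x)
  · exact Set.disjoint_left.2 fun x hx hx' => ne_of_lt hx hx'

lemma measure_lt_gain_eq (g : ℝ) :
    PH.real {h | g < gain h} = 1 - PH.real {h | gain h ≤ g} := by
  rw [← probReal_compl_eq_one_sub (measurableSet_gain_le g)]
  congr 1
  ext x
  simp

lemma integrable_indicator_inv_gain {μ : ℝ} (hμ : 0 < μ) :
    Integrable (Set.indicator {h | μ < gain h} fun h => 1 / gain h) PH := by
  refine Integrable.of_bound (C := 1 / μ)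
    ((Measurable.indicator (by fun_prop) (measurableSet_lt_gain μ)).aestronglyMeasurable)
    (ae_of_all _ fun h => ?_)
  by_cases hh : μ < gain h
  · rw [Set.indicator_of_mem (show h ∈ {h | μ < gain h} from hh), Real.norm_eq_abs,
      abs_of_nonneg (by have := gain_nonneg h; positivity)]
    exact one_div_le_one_div_of_le hμ hh.le
  · rw [Set.indicator_of_notMem (show h ∉ {h | μ < gain h} from hh)]
    simp [hμ.le]

/-- The optimality of truncated channel inversion: among the transmission probabilities with a given
average inverse gain, a threshold rule maximizes the total probability. -/
lemma integral_le_of_transmission {t : ℝ} (hμ : 0 < genInv PH t) {p : ℂ → ℝ}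
    (hp : Integrable p PH) (hpg : Integrable (fun h => p h / gain h) PH) (hp0 : ∀ h, 0 ≤ p h)
    (hp1 : ∀ h, p h ≤ 1) (hpz : ∀ h, gain h = 0 → p h = 0) :
    ∫ h, p h ∂PH ≤ genInv PH t * ∫ h, p h / gain h ∂PH + 1 - t -
      genInv PH t * avgInvGain PH t := by
  obtain ⟨μ, hμe⟩ : ∃ μ, μ = genInv PH t := ⟨_, rfl⟩
  have hi1 : Integrable (Set.indicator {h | μ < gain h} fun _ => (1 : ℝ)) PH :=
    (integrable_const 1).indicator (measurableSet_lt_gain μ)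
  have hi2 := integrable_indicator_inv_gain (PH := PH) (μ := μ) (hμe ▸ hμ)
  -- Lagrangian duality: for 0 ≤ p ≤ 1 and g > 0, p ≤ μp/g + (1 - μ/g)⁺, with equality for every
  -- rule that transmits above the threshold μ and is silent below it.
  have hpt : ∀ h, p h ≤ μ * (p h / gain h) + (Set.indicator {h | μ < gain h} (fun _ => (1 : ℝ)) h
      - μ * Set.indicator {h | μ < gain h} (fun h => 1 / gain h) h) := by
    intro h
    rcases eq_or_lt_of_le (gain_nonneg h) with hz | hpos
    · have : ¬ μ < gain h := by rw [← hz, hμe]; exact not_lt.2 hμ.le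
      rw [Set.indicator_of_notMem (show h ∉ {h | μ < gain h} from this),
        Set.indicator_of_notMem (show h ∉ {h | μ < gain h} from this), hpz h hz.symm]
      simp
    · by_cases hh : μ < gain h
      · rw [Set.indicator_of_mem (show h ∈ {h | μ < gain h} from hh),
          Set.indicator_of_mem (show h ∈ {h | μ < gain h} from hh)]
        have h1 : μ / gain h ≤ 1 := (div_le_one hpos).2 hh.le
        have e : μ * (p h / gain h) + (1 - μ * (1 / gain h)) - p h =
          (1 - p h) * (1 - μ / gain h) := by ring
        have := mul_nonneg (sub_nonneg.2 (hp1 h)) (sub_nonneg.2 h1)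
        linarith
      · rw [Set.indicator_of_notMem (show h ∉ {h | μ < gain h} from hh),
          Set.indicator_of_notMem (show h ∉ {h | μ < gain h} from hh)]
        have h1 : 1 ≤ μ / gain h := (one_le_div hpos).2 (not_lt.1 hh)
        have e : μ * (p h / gain h) = p h * (μ / gain h) := by ring
        rw [e]
        nlinarith [hp0 h]
  have := integral_mono hp ((hpg.const_mul μ).add (hi1.sub (hi2.const_mul μ))) hpt
  rw [integral_add' (hpg.const_mul μ) (hi1.sub (hi2.const_mul μ)),
    integral_sub' hi1 (hi2.const_mul μ), integral_const_mul, integral_const_mul,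
    integral_indicator_const _ (measurableSet_lt_gain μ), measure_lt_gain_eq] at this
  rw [avgInvGain, ← hμe, mul_add, mul_div_cancel₀ _ (by rw [hμe]; exact hμ.ne')]
  simp only [smul_eq_mul, mul_one] at this
  linarith

/-- The transmission probability of truncated channel inversion with threshold `μ` and probability
`θ` at the threshold. -/
def transmission (μ θ : ℝ) (h : ℂ) : ℝ :=
  Set.indicator {h | μ < gain h} (fun _ => 1) h + θ * Set.indicator {h | gain h = μ} (fun _ => 1) h

lemma integrable_indicator_gain_eq (μ : ℝ) :
    Integrable (Set.indicator {h | gain h = μ} fun _ => (1 : ℝ)) PH :=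
  (integrable_const 1).indicator (measurableSet_gain_eq μ)

lemma integrable_transmission (μ θ : ℝ) : Integrable (transmission μ θ) PH :=
  ((integrable_const 1).indicator (measurableSet_lt_gain μ)).add
    ((integrable_indicator_gain_eq μ).const_mul θ)

lemma integral_transmission (μ θ : ℝ) : ∫ h, transmission μ θ h ∂PH =
    1 - PH.real {h | gain h ≤ μ} + θ * PH.real {h | gain h = μ} := by
  have e : transmission μ θ = (Set.indicator {h | μ < gain h} fun _ => (1 : ℝ)) +
    fun h => θ * Set.indicator {h | gain h = μ} (fun _ => (1 : ℝ)) h := rfl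
  rw [e, integral_add' ((integrable_const 1).indicator (measurableSet_lt_gain μ))
    ((integrable_indicator_gain_eq μ).const_mul θ), integral_const_mul,
    integral_indicator_const _ (measurableSet_lt_gain μ),
    integral_indicator_const _ (measurableSet_gain_eq μ), measure_lt_gain_eq]
  simp

lemma transmission_div_gain (μ θ : ℝ) (h : ℂ) : transmission μ θ h / gain h =
    Set.indicator {h | μ < gain h} (fun h => 1 / gain h) h +
      θ / μ * Set.indicator {h | gain h = μ} (fun _ => 1) h := by
  rw [transmission]
  by_cases h1 : gain h = μ
  · have h2 : ¬ μ < gain h := by rw [h1]; exact lt_irrefl _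
    rw [Set.indicator_of_notMem (show h ∉ {h | μ < gain h} from h2),
      Set.indicator_of_notMem (show h ∉ {h | μ < gain h} from h2),
      Set.indicator_of_mem (show h ∈ {h | gain h = μ} from h1), h1]
    simp
  · rw [Set.indicator_of_notMem (show h ∉ {h | gain h = μ} from h1)]
    by_cases h2 : μ < gain h
    · rw [Set.indicator_of_mem (show h ∈ {h | μ < gain h} from h2),
        Set.indicator_of_mem (show h ∈ {h | μ < gain h} from h2)]
      simp
    · rw [Set.indicator_of_notMem (show h ∉ {h | μ < gain h} from h2),
        Set.indicator_of_notMem (show h ∉ {h | μ < gain h} from h2)]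
      simp

lemma integrable_transmission_div_gain {μ : ℝ} (hμ : 0 < μ) (θ : ℝ) :
    Integrable (fun h => transmission μ θ h / gain h) PH := by
  simp_rw [transmission_div_gain]
  exact (integrable_indicator_inv_gain hμ).add ((integrable_indicator_gain_eq μ).const_mul _)

lemma integral_transmission_div_gain {μ : ℝ} (hμ : 0 < μ) (θ : ℝ) :
    ∫ h, transmission μ θ h / gain h ∂PH =
      (∫ h, Set.indicator {h | μ < gain h} (fun h => 1 / gain h) h ∂PH) +
        θ * PH.real {h | gain h = μ} / μ := by
  simp_rw [transmission_div_gain]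
  rw [integral_add (integrable_indicator_inv_gain hμ)
    ((integrable_indicator_gain_eq μ).const_mul _), integral_const_mul,
    integral_indicator_const _ (measurableSet_gain_eq μ)]
  simp [div_mul_eq_mul_div]

/-- The randomization at the threshold that makes the outage probability equal to `t`. -/
lemma exists_threshold_probability {t : ℝ} (ht0 : 0 ≤ t) (ht1 : t < 1) :
    ∃ θ : ℝ, 0 ≤ θ ∧ θ ≤ 1 ∧
      θ * PH.real {h | gain h = genInv PH t} = PH.real {h | gain h ≤ genInv PH t} - t := by
  have h1 := measure_gain_le_eq (PH := PH) (genInv PH t)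
  have h2 := measure_lt_genInv_le (PH := PH) ht0
  have h3 := le_measure_le_genInv (PH := PH) ht1
  have h4 : 0 ≤ PH.real {h | gain h = genInv PH t} := measureReal_nonneg
  rcases h4.eq_or_lt with h5 | h5
  · exact ⟨0, le_rfl, zero_le_one, by rw [← h5] at h1 ⊢; linarith⟩
  · refine ⟨(PH.real {h | gain h ≤ genInv PH t} - t) / PH.real {h | gain h = genInv PH t},
      div_nonneg (by linarith) h4, (div_le_one h5).2 (by linarith), div_mul_cancel₀ _ h5.ne'⟩

lemma transmission_nonneg {μ θ : ℝ} (hθ : 0 ≤ θ) (h : ℂ) : 0 ≤ transmission μ θ h :=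
  add_nonneg (Set.indicator_nonneg (fun _ _ => zero_le_one) _)
    (mul_nonneg hθ (Set.indicator_nonneg (fun _ _ => zero_le_one) _))

lemma transmission_le_one {μ θ : ℝ} (hθ : θ ≤ 1) (h : ℂ) : transmission μ θ h ≤ 1 := by
  rw [transmission]
  by_cases h1 : gain h = μ
  · have h2 : ¬ μ < gain h := by rw [h1]; exact lt_irrefl _
    rw [Set.indicator_of_notMem (show h ∉ {h | μ < gain h} from h2),
      Set.indicator_of_mem (show h ∈ {h | gain h = μ} from h1)]
    simpa
  · rw [Set.indicator_of_notMem (show h ∉ {h | gain h = μ} from h1)]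
    simpa using Set.indicator_le' (s := {h | μ < gain h}) (f := fun _ => (1 : ℝ)) (g := 1)
      (fun _ _ => le_rfl) (fun _ _ => zero_le_one) h

lemma transmission_eq_zero {μ θ : ℝ} {h : ℂ} (hh : gain h < μ) : transmission μ θ h = 0 := by
  rw [transmission, Set.indicator_of_notMem (show h ∉ {h | μ < gain h} from not_lt.2 hh.le),
    Set.indicator_of_notMem (show h ∉ {h | gain h = μ} from ne_of_lt hh)]
  simp

/-- Truncated inversion at level t, of probability 1 - t and cost ḡ_t, is a competitor in the
knapsack bound at level s. The resulting one-sided Lipschitz bound controls the power lost by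
lowering the outage level. -/
lemma avgInvGain_le_add {s t : ℝ} (hs0 : 0 ≤ s) (hst : s ≤ t) (ht1 : t < 1)
    (hμ : 0 < genInv PH s) :
    avgInvGain PH s ≤ avgInvGain PH t + (t - s) / genInv PH s := by
  have ht0 := hs0.trans hst
  have hμt := hμ.trans_le (genInv_mono (PH := PH) hs0 hst ht1)
  obtain ⟨θ, hθ0, hθ1, hθ⟩ := exists_threshold_probability (PH := PH) ht0 ht1
  have h1 := integral_le_of_transmission hμ (integrable_transmission (PH := PH) (genInv PH t) θ)
    (integrable_transmission_div_gain hμt θ) (transmission_nonneg hθ0) (transmission_le_one hθ1)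
    (fun h hh => transmission_eq_zero (by rw [hh]; exact hμt))
  rw [integral_transmission, integral_transmission_div_gain hμt, hθ, ← avgInvGain] at h1
  rw [← sub_le_iff_le_add', le_div_iff₀ hμ]
  linarith

/-- Both summands are nonnegative. If both vanished, the gain would almost surely not exceed F⁻¹(t),
while P[G ≤ F⁻¹(t)] ≤ t < 1. -/
lemma avgInvGain_pos {t : ℝ} (ht1 : t < 1) (hμ : 0 < genInv PH t) : 0 < avgInvGain PH t := by
  have h3 := le_measure_le_genInv (PH := PH) ht1
  have hnn : 0 ≤ ∫ h, Set.indicator {h | genInv PH t < gain h} (fun h => 1 / gain h) h ∂PH :=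
    integral_nonneg fun h => Set.indicator_nonneg
      (fun h _ => one_div_nonneg.2 (gain_nonneg h)) h
  rw [avgInvGain]
  by_contra hle
  have h4 : 0 ≤ (PH.real {h | gain h ≤ genInv PH t} - t) / genInv PH t :=
    div_nonneg (by linarith) hμ.le
  have h5 : ∫ h, Set.indicator {h | genInv PH t < gain h} (fun h => 1 / gain h) h ∂PH = 0 := by
    linarith
  have h6 : PH.real {h | gain h ≤ genInv PH t} - t ≤ 0 := by
    by_contra hc
    have := div_pos (not_le.1 hc) hμ
    linarith
  rw [integral_eq_zero_iff_of_nonneg (fun h => Set.indicator_nonneg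
    (fun h _ => one_div_nonneg.2 (gain_nonneg h)) h) (integrable_indicator_inv_gain hμ)] at h5
  have h7 : PH {h | genInv PH t < gain h} = 0 := by
    refine measure_mono_null (fun h hh => ?_) h5
    have hh' : genInv PH t < gain h := hh
    have : Set.indicator {h | genInv PH t < gain h} (fun h => 1 / gain h) h = 1 / gain h :=
      Set.indicator_of_mem hh _
    show ¬ (Set.indicator {h | genInv PH t < gain h} (fun h => 1 / gain h) h = 0)
    rw [this]
    exact (one_div_pos.2 (hμ.trans hh')).ne'
  have h8 := measure_lt_gain_eq (PH := PH) (genInv PH t)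
  rw [measureReal_def, h7] at h8
  simp at h8
  linarith

end

/-! ### Feinstein's construction and AWGN codes -/

/-- Feinstein's maximal coding argument: codewords in `F` and disjoint decoding regions inside the
sets `B x` can be added one after the other as long as the regions leave enough room. -/
lemma exists_codebook {X Y : Type*} [MeasurableSpace X] [MeasurableSpace Y] [Nonempty X]
    {P : X → Measure Y} {Q : Measure Y} {μ : Measure X} {F : Set X} {B : X → Set Y}
    {δ τ κ : ℝ≥0∞} (hF : MeasurableSet F) (hB : ∀ x, MeasurableSet (B x))
    (hQ : ∀ A, MeasurableSet A → ∫⁻ x in F, P x A ∂μ ≤ Q A) (hQB : ∀ x, Q (B x) ≤ κ)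
    (hPB : ∀ x ∈ F, P x (B x)ᶜ ≤ δ) (m : ℕ) (hm : ∀ k < m, k * κ < τ * μ F) :
    ∃ (c : ℕ → X) (g : Y → ℕ), Measurable g ∧
      (∀ j < m, c j ∈ F ∧ P (c j) {y | g y ≠ j} ≤ δ + τ) ∧ Q {y | g y < m} ≤ m * κ := by
  classical
  induction m with
  | zero =>
    obtain ⟨x⟩ := ‹Nonempty X›
    exact ⟨fun _ => x, fun _ => 0, measurable_const, by simp, by simp⟩
  | succ m ih =>
    obtain ⟨c, g, hg, hc, hQg⟩ := ih fun k hk => hm k (by omega)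
    have hU : MeasurableSet {y | g y < m} := measurableSet_lt hg measurable_const
    obtain ⟨x, hxF, hx⟩ : ∃ x ∈ F, P x {y | g y < m} ≤ τ := by
      -- If the occupied region had probability above τ from every x in F, averaging over F would
      -- give it Q-measure at least τ μ(F), but it has at most mκ.
      by_contra! hcon
      have h1 : τ * μ F ≤ ∫⁻ x in F, P x {y | g y < m} ∂μ := by
        rw [← setLIntegral_const]
        exact setLIntegral_mono' hF fun x hx => (hcon x hx).le
      exact absurd (hm m (by omega)) (not_lt.2 (h1.trans ((hQ _ hU).trans hQg)))
    -- The new region is B x minus the occupied part, so earlier decisions do not change. Undecided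
    -- outputs move to m + 1, because m now names the new codeword.
    refine ⟨Function.update c m x, fun y => if g y < m then g y else if y ∈ B x then m else m + 1,
      Measurable.ite hU hg (Measurable.ite (hB x) measurable_const measurable_const),
      fun j hj => ?_, ?_⟩
    · rcases Nat.lt_succ_iff_lt_or_eq.1 hj with hj | rfl
      · rw [Function.update_of_ne hj.ne]
        refine ⟨(hc j hj).1, le_trans (measure_mono fun y hy => ?_) (hc j hj).2⟩
        intro hgy
        refine hy ?_
        simp only [hgy, if_pos hj]
      · rw [Function.update_self]
        refine ⟨hxF, ?_⟩
        calc _ ≤ P x ((B x)ᶜ ∪ {y | g y < j}) := by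
              refine measure_mono fun y hy => ?_
              by_contra hcon
              rw [Set.mem_union, not_or, Set.mem_compl_iff, not_not] at hcon
              have hlt : ¬ g y < j := hcon.2
              refine hy ?_
              simp only [if_neg hlt, if_pos hcon.1]
          _ ≤ _ := (measure_union_le _ _).trans (add_le_add (hPB x hxF) hx)
    · calc _ ≤ Q ({y | g y < m} ∪ B x) := by
            refine measure_mono fun y hy => ?_
            by_contra hcon
            rw [Set.mem_union, not_or] at hcon
            have hy' : (if g y < m then g y else if y ∈ B x then m else m + 1) < m + 1 := hy
            have hlt : ¬ g y < m := hcon.1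
            rw [if_neg hlt, if_neg hcon.2] at hy'
            exact lt_irrefl _ hy'
        _ ≤ _ := (measure_union_le _ _).trans (add_le_add hQg (hQB x))
        _ = _ := by push_cast; ring

/-- Codes for the AWGN channel under a short-term power constraint slightly below `w`, with maximal
error probability of order `1 / √n`. -/
lemma exists_awgn_code {w : ℝ} (hw : 0 < w) {c : ℝ} (hc : 0 ≤ c) :
    ∃ K : ℝ, 0 ≤ K ∧ ∀ᶠ n : ℕ in atTop, ∃ M : ℕ, 0 < M ∧
      n * Real.log (1 + w) - √n * √(dispersion w) * √(Real.log n) - K * √n ≤ Real.log M ∧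
      ∃ (book : Fin M → (Fin n → ℂ)) (dec : (Fin n → ℂ) → Fin M), Measurable dec ∧
        ∀ j, energy (book j) ≤ n * w - c * √n ∧
          noise n {z | dec (book j + z) ≠ j} ≤ ENNReal.ofReal (3 / √n) := by
  obtain ⟨p, B, hp, hB, hshell⟩ := eventually_le_gaussVec_shell hw hc
  refine ⟨B / (1 + w) + |Real.log p| + 1, by positivity, ?_⟩
  filter_upwards [hshell, eventually_infoDensity_lower_tail_le hw 0 le_rfl,
    eventually_gt_atTop 0] with n hs htail hn
  have hn1 : (1 : ℝ) ≤ n := by exact_mod_cast hn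
  have ht1 : 1 ≤ √(n : ℝ) := Real.one_le_sqrt.2 hn1
  obtain ⟨t, ht⟩ : ∃ t, t = √(n : ℝ) := ⟨_, rfl⟩
  rw [← ht] at ht1
  have ht0 : 0 < t := by linarith
  have hw1 : 0 < 1 + w := by positivity
  -- On the shell the mean of the information density loses at most B√n/(1+w), so T is no larger
  -- than the point where the lower tail bound applies.
  obtain ⟨T, hT⟩ : ∃ T, T = n * Real.log (1 + w) - t * √(dispersion w) * √(Real.log n) -
    B / (1 + w) * t := ⟨_, rfl⟩
  have := isProbabilityMeasure_gaussVec (n := n) hw 0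
  obtain ⟨F, hFdef⟩ : ∃ F : Set (Fin n → ℂ),
    F = {x | n * w - B * t ≤ energy x ∧ energy x ≤ n * w - c * t} := ⟨_, rfl⟩
  simp only [← ht] at hs htail ⊢
  rw [← hFdef] at hs
  have hF : MeasurableSet F := by
    rw [hFdef]
    exact (measurableSet_le measurable_const measurable_energy).inter
      (measurableSet_le measurable_energy measurable_const)
  have hBm : ∀ x : Fin n → ℂ, MeasurableSet {y | T < infoDensity w x (y - x)} := fun x =>
    measurableSet_lt measurable_const ((measurable_infoDensity w x).comp (measurable_id.sub_const x))
  -- Feinstein's room condition k exp(-T) < τ μ(F), with τ = 1/√n and μ(F) ≥ p, holds for every k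
  -- below this ceiling.
  obtain ⟨M, hM⟩ : ∃ M, M = ⌈p * Real.exp T / t⌉₊ := ⟨_, rfl⟩
  have hM0 : 0 < M := by rw [hM]; exact Nat.ceil_pos.2 (by positivity)
  have hpF : ENNReal.ofReal p ≤ gaussVec w 0 F := by
    rw [← ofReal_measureReal]
    exact ENNReal.ofReal_le_ofReal hs
  obtain ⟨book, g, hg, hbook, -⟩ := exists_codebook (P := gaussVec 1) (Q := gaussVec (1 + w) 0)
    (μ := gaussVec w 0) (F := F) (δ := ENNReal.ofReal (2 / t)) (τ := ENNReal.ofReal (1 / t))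
    (κ := ENNReal.ofReal (Real.exp (-T))) hF hBm
    (fun A hA => (setLIntegral_le_lintegral _ _).trans (lintegral_gaussVec_one hw hA).le)
    (fun x => gaussVec_lt_infoDensity_le hw x T)
    (by
      intro x hx
      rw [hFdef] at hx
      have hset : noise n {z | infoDensity w x z ≤ T} =
          gaussVec 1 x {y | T < infoDensity w x (y - x)}ᶜ := by
        rw [← noise_preimage_add x (hBm x).compl]
        congr 1
        ext z
        simp
      rw [← hset, ← ofReal_measureReal]
      refine ENNReal.ofReal_le_ofReal (le_trans (measureReal_mono fun z hz => ?_) (htail x ?_))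
      · refine le_trans (show infoDensity w x z ≤ T from hz) ?_
        have : -(B / (1 + w) * t) ≤ (energy x - n * w) / (1 + w) := by
          rw [div_mul_eq_mul_div, ← neg_div, div_le_div_iff_of_pos_right hw1]
          linarith [hx.1]
        rw [hT, infoMean]
        linarith
      · have : 0 ≤ c * t := by positivity
        linarith [hx.2])
    M (by
      intro k hk
      have hk' : (k : ℝ) < p * Real.exp T / t := Nat.lt_ceil.1 (hM ▸ hk)
      refine lt_of_lt_of_le ?_ (mul_le_mul_right hpF _)
      rw [← ENNReal.ofReal_natCast, ← ENNReal.ofReal_mul (Nat.cast_nonneg k),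
        ← ENNReal.ofReal_mul (by positivity), ENNReal.ofReal_lt_ofReal_iff (by positivity)]
      calc (k : ℝ) * Real.exp (-T) < p * Real.exp T / t * Real.exp (-T) := by
            gcongr
        _ = 1 / t * p := by
            rw [Real.exp_neg]
            field_simp)
  refine ⟨M, hM0, ?_, fun j => book j, fun y => if h : g y < M then ⟨g y, h⟩ else ⟨0, hM0⟩, ?_, ?_⟩
  · have h1 : p * Real.exp T / t ≤ M := by rw [hM]; exact Nat.le_ceil _
    have h2 := Real.log_le_log (by positivity) h1
    rw [Real.log_div (by positivity) ht0.ne', Real.log_mul hp.ne' (Real.exp_pos T).ne',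
      Real.log_exp] at h2
    have h3 := Real.log_le_sub_one_of_pos ht0
    have h4 := neg_abs_le (Real.log p)
    have h5 : |Real.log p| ≤ |Real.log p| * t := le_mul_of_one_le_right (abs_nonneg _) ht1
    rw [hT] at h2
    linarith
  · exact (Measurable.of_discrete (f := fun k : ℕ =>
      if h : k < M then (⟨k, h⟩ : Fin M) else ⟨0, hM0⟩)).comp hg
  · intro j
    obtain ⟨h1, h2⟩ := hbook j j.2
    rw [hFdef] at h1
    refine ⟨h1.2, ?_⟩
    calc _ ≤ noise n {z | book j + z ∈ {y | g y ≠ j}} := by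
          refine measure_mono fun z hz hgz => hz ?_
          have hgz' : g (book j + z) = j := hgz
          simp only [hgz', j.2, dif_pos]
      _ = gaussVec 1 (book j) {y | g y ≠ j} :=
          noise_preimage_add _ (measurableSet_eq_fun hg measurable_const).compl
      _ ≤ _ := h2
      _ = _ := by
          rw [← ENNReal.ofReal_add (by positivity) (by positivity)]
          congr 1
          ring

/-! ### From AWGN codes to truncated channel inversion -/

open scoped Classical in
/-- Truncated channel inversion of a codebook, followed by a decoder that undoes the phase shift of
the channel. -/
def inversionCode {n M : ℕ} (γ : ℝ) (S : Finset (Fin M)) (book : Fin M → (Fin n → ℂ))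
    (dec : (Fin n → ℂ) → Fin M) (hdec : Measurable dec) : Code n M where
  enc j h := if γ < gain h ∨ (gain h = γ ∧ j ∈ S) then (fun i => ((‖h‖⁻¹ : ℝ) : ℂ) * book j i)
    else 0
  dec p := dec fun i => (starRingEnd ℂ p.2 * ((‖p.2‖⁻¹ : ℝ) : ℂ)) * p.1 i
  measurable_enc j := by
    refine Measurable.ite ?_ (by fun_prop) measurable_const
    exact (measurableSet_lt_gain γ).union ((measurableSet_gain_eq γ).inter (.const _))
  measurable_dec := by
    refine hdec.comp ?_
    have : Measurable (starRingEnd ℂ) := Complex.continuous_conj.measurable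
    fun_prop

lemma transmission_eq_ite {γ : ℝ} (h : ℂ) (q : Prop) [Decidable q]
    [Decidable (γ < gain h ∨ (gain h = γ ∧ q))] :
    transmission γ (if q then 1 else 0) h = if γ < gain h ∨ (gain h = γ ∧ q) then 1 else 0 := by
  classical
  rw [transmission]
  simp only [Set.indicator_apply, Set.mem_ofPred_eq]
  by_cases h1 : gain h = γ
  · simp [h1]
  · simp [h1]

open scoped Classical in
-- Holds at `h = 0` too, where both inverses are 0 by convention.
lemma energy_inversionCode {n M : ℕ} (γ : ℝ) (S : Finset (Fin M))
    (book : Fin M → (Fin n → ℂ)) (dec : (Fin n → ℂ) → Fin M) (hdec : Measurable dec) (j : Fin M)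
    (h : ℂ) : energy ((inversionCode γ S book dec hdec).enc j h) =
      transmission γ (if j ∈ S then 1 else 0) h / gain h * energy (book j) := by
  rw [transmission_eq_ite]
  simp only [inversionCode]
  split_ifs with hh
  · rw [energy_mul]
    congr 1
    simp [gain]
  · simp [energy_zero]

open scoped Classical in
-- When the codeword is sent, the decoder's phase correction recovers it plus a rotated noise of the
-- same law. When it is silenced, the error probability is bounded by 1, the value of 1 -
-- transmission.
lemma noise_inversionCode_le {n M : ℕ} {γ : ℝ} (hγ : 0 < γ) (S : Finset (Fin M))
    (book : Fin M → (Fin n → ℂ)) (dec : (Fin n → ℂ) → Fin M) (hdec : Measurable dec) (j : Fin M)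
    {δ : ℝ} (hδ : 0 ≤ δ) (herr : noise n {z | dec (book j + z) ≠ j} ≤ ENNReal.ofReal δ) (h : ℂ) :
    noise n {z | (inversionCode γ S book dec hdec).dec
      (output h ((inversionCode γ S book dec hdec).enc j h) z, h) ≠ j} ≤
      ENNReal.ofReal (δ + (1 - transmission γ (if j ∈ S then 1 else 0) h)) := by
  rw [transmission_eq_ite]
  by_cases hh : γ < gain h ∨ (gain h = γ ∧ j ∈ S)
  · have hg : 0 < gain h := by
      rcases hh with h1 | h1
      · linarith
      · rw [h1.1]; exact hγ
    have hne : ‖h‖ ≠ 0 := by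
      intro h0
      rw [gain, h0] at hg
      norm_num at hg
    have hneC : ((‖h‖ : ℝ) : ℂ) ≠ 0 := by exact_mod_cast hne
    have hu : ‖starRingEnd ℂ h * ((‖h‖⁻¹ : ℝ) : ℂ)‖ = 1 := by
      rw [norm_mul, RCLike.norm_conj, Complex.norm_real, norm_inv, norm_norm, mul_inv_cancel₀ hne]
    rw [if_pos hh, sub_self, add_zero]
    refine le_trans (le_of_eq ?_) herr
    have hA : MeasurableSet {z | dec (book j + z) ≠ j} :=
      (measurableSet_eq_fun (hdec.comp (measurable_const_add _)) measurable_const).compl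
    rw [← (measurePreserving_rotate_noise _ hu).measure_preimage hA.nullMeasurableSet]
    congr 1
    ext z
    simp only [inversionCode, if_pos hh, Set.mem_ofPred_eq, Set.mem_preimage]
    have e : (fun i => starRingEnd ℂ h * ((‖h‖⁻¹ : ℝ) : ℂ) *
        output h (fun i => ((‖h‖⁻¹ : ℝ) : ℂ) * book j i) z i) =
        book j + fun i => starRingEnd ℂ h * ((‖h‖⁻¹ : ℝ) : ℂ) * z i := by
      funext i
      simp only [output, Pi.add_apply, mul_add]
      congr 1
      have h2 : starRingEnd ℂ h * h = ((‖h‖ : ℝ) : ℂ) * ((‖h‖ : ℝ) : ℂ) := by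
        rw [Complex.conj_mul', sq]
      calc _ = (starRingEnd ℂ h * h) * ((‖h‖⁻¹ : ℝ) : ℂ) * ((‖h‖⁻¹ : ℝ) : ℂ) * book j i := by ring
        _ = _ := by
          rw [h2]
          push_cast
          field_simp
    rw [e]
  · rw [if_neg hh, sub_zero]
    exact prob_le_one.trans (by rw [← ENNReal.ofReal_one]; exact ENNReal.ofReal_le_ofReal (by linarith))

section

variable {PH : Measure ℂ} [IsProbabilityMeasure PH]

lemma measurableSet_error {n M : ℕ} (c : Code n M) (j : Fin M) :
    MeasurableSet {p : ℂ × (Fin n → ℂ) | c.dec (output p.1 (c.enc j p.1) p.2, p.1) = j} := by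
  have h1 : Measurable fun p : ℂ × (Fin n → ℂ) => output p.1 (c.enc j p.1) p.2 := by
    refine measurable_pi_lambda _ fun i => ?_
    have h2 : Measurable fun p : ℂ × (Fin n → ℂ) => c.enc j p.1 i :=
      (measurable_pi_apply i).comp ((c.measurable_enc j).comp measurable_fst)
    unfold output
    fun_prop
  exact measurableSet_eq_fun (c.measurable_dec.comp (h1.prodMk measurable_fst)) measurable_const

/-- Truncated channel inversion turns codes for the AWGN channel into codes for the fading
channel. -/
lemma exists_inversionCode {n M : ℕ} (hM : 0 < M) {ρ ε t δ : ℝ} (hρ : 0 < ρ) (ht0 : 0 ≤ t)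
    (ht1 : t < 1) (hγ : 0 < genInv PH t) (book : Fin M → (Fin n → ℂ))
    (dec : (Fin n → ℂ) → Fin M) (hdec : Measurable dec) (hδ : 0 ≤ δ)
    (hbook : ∀ j, energy (book j) ≤ n * (ρ / avgInvGain PH t))
    (herr : ∀ j, noise n {z | dec (book j + z) ≠ j} ≤ ENNReal.ofReal δ)
    (hε : t + δ + 1 / M ≤ ε) :
    ∃ c : Code n M, c.IsAdmissible PH ρ ε ∧
      c.IsTruncatedInversion (genInv PH t) (ρ / avgInvGain PH t) := by
  classical
  have hgb := avgInvGain_pos ht1 hγ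
  have hM' : (0 : ℝ) < M := by exact_mod_cast hM
  obtain ⟨θ, hθ0, hθ1, hθ⟩ := exists_threshold_probability (PH := PH) ht0 ht1
  -- The randomization at an atom is carried by the message: ⌊θM⌋ of the messages transmit at the
  -- threshold. Rounding down respects the power constraint and costs at most 1/M in error
  -- probability.
  have hfloor : ⌊θ * M⌋₊ ≤ (Finset.univ : Finset (Fin M)).card := by
    rw [Finset.card_univ, Fintype.card_fin]
    exact Nat.floor_le_of_le (by nlinarith)
  obtain ⟨S, -, hS⟩ := Finset.exists_subset_card_eq hfloor
  have hSle : (S.card : ℝ) ≤ θ * M := by rw [hS]; exact Nat.floor_le (by positivity)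
  have hSge : θ * M - 1 ≤ S.card := by rw [hS]; exact (Nat.sub_one_lt_floor _).le
  have hsum : ∑ j : Fin M, (if j ∈ S then (1 : ℝ) else 0) = S.card := by simp
  have hP0 : 0 ≤ PH.real {h | gain h = genInv PH t} := measureReal_nonneg
  have hP1 : PH.real {h | gain h = genInv PH t} ≤ 1 := measureReal_le_one
  have hq0 : ∀ j : Fin M, 0 ≤ (if j ∈ S then (1 : ℝ) else 0) := fun j => by split_ifs <;> norm_num
  have hq1 : ∀ j : Fin M, (if j ∈ S then (1 : ℝ) else 0) ≤ 1 := fun j => by split_ifs <;> norm_num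
  refine ⟨inversionCode (genInv PH t) S book dec hdec, ⟨?_, ?_⟩, hγ, book, S, hbook,
    fun j h => rfl⟩
  · have h1 : ∀ j, ∫⁻ h, ENNReal.ofReal
        (energy ((inversionCode (genInv PH t) S book dec hdec).enc j h)) ∂PH ≤
        ENNReal.ofReal ((∫ h, transmission (genInv PH t) (if j ∈ S then 1 else 0) h / gain h ∂PH) *
          (n * (ρ / avgInvGain PH t))) := by
      intro j
      rw [← integral_mul_const, ofReal_integral_eq_lintegral_ofReal
        ((integrable_transmission_div_gain hγ _).mul_const _) (ae_of_all _ fun h => mul_nonneg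
          (div_nonneg (transmission_nonneg (hq0 j) h) (gain_nonneg h)) (by positivity))]
      refine lintegral_mono fun h => ENNReal.ofReal_le_ofReal ?_
      rw [energy_inversionCode]
      exact mul_le_mul_of_nonneg_left (hbook j)
        (div_nonneg (transmission_nonneg (hq0 j) h) (gain_nonneg h))
    rw [Code.avgEnergy]
    calc _ ≤ (M : ℝ≥0∞)⁻¹ * ∑ j : Fin M, ENNReal.ofReal
          ((∫ h, transmission (genInv PH t) (if j ∈ S then 1 else 0) h / gain h ∂PH) *
          (n * (ρ / avgInvGain PH t))) := by gcongr with j; exact h1 j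
      _ = ENNReal.ofReal ((M : ℝ)⁻¹ * ∑ j : Fin M,
          ((∫ h, transmission (genInv PH t) (if j ∈ S then 1 else 0) h / gain h ∂PH) *
          (n * (ρ / avgInvGain PH t)))) := by
          rw [ENNReal.ofReal_mul (by positivity), ENNReal.ofReal_inv_of_pos hM',
            ENNReal.ofReal_natCast, ENNReal.ofReal_sum_of_nonneg]
          intro j _
          exact mul_nonneg (integral_nonneg fun h =>
            div_nonneg (transmission_nonneg (hq0 j) h) (gain_nonneg h)) (by positivity)
      _ ≤ _ := by
          refine ENNReal.ofReal_le_ofReal ?_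
          simp_rw [integral_transmission_div_gain hγ]
          rw [← Finset.sum_mul, Finset.sum_add_distrib, ← Finset.sum_div, ← Finset.sum_mul, hsum,
            Finset.sum_const, Finset.card_univ, Fintype.card_fin, nsmul_eq_mul, ← mul_assoc,
            mul_add, inv_mul_cancel_left₀ hM'.ne']
          have h2 : (M : ℝ)⁻¹ * (S.card * PH.real {h | gain h = genInv PH t} / genInv PH t) ≤
              (PH.real {h | gain h ≤ genInv PH t} - t) / genInv PH t := by
            rw [← hθ, ← mul_div_assoc, div_le_div_iff_of_pos_right hγ, ← mul_assoc]
            refine mul_le_mul_of_nonneg_right ?_ hP0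
            rw [inv_mul_le_iff₀ hM']
            linarith
          calc _ ≤ avgInvGain PH t * (n * (ρ / avgInvGain PH t)) := by
                refine mul_le_mul_of_nonneg_right ?_ (by positivity)
                rw [avgInvGain]
                linarith
            _ = _ := by field_simp
  · have h1 : ∀ j, (PH.prod (noise n)).real {p : ℂ × (Fin n → ℂ) |
        (inversionCode (genInv PH t) S book dec hdec).dec (output p.1
          ((inversionCode (genInv PH t) S book dec hdec).enc j p.1) p.2, p.1) ≠ j} ≤
        δ + (PH.real {h | gain h ≤ genInv PH t} -
          (if j ∈ S then (1 : ℝ) else 0) * PH.real {h | gain h = genInv PH t}) := by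
      intro j
      have hint : Integrable (fun h => δ + (1 - transmission (genInv PH t)
          (if j ∈ S then 1 else 0) h)) PH :=
        (integrable_const δ).add ((integrable_const 1).sub (integrable_transmission _ _))
      have hnn : ∀ h, 0 ≤ δ + (1 - transmission (genInv PH t) (if j ∈ S then 1 else 0) h) :=
        fun h => add_nonneg hδ (sub_nonneg.2 (transmission_le_one (hq1 j) h))
      have h2 : ∫ h, (δ + (1 - transmission (genInv PH t) (if j ∈ S then 1 else 0) h)) ∂PH =
          δ + (PH.real {h | gain h ≤ genInv PH t} -
          (if j ∈ S then (1 : ℝ) else 0) * PH.real {h | gain h = genInv PH t}) := by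
        rw [integral_add (f := fun _ => δ) (integrable_const δ)
          (g := fun h => 1 - transmission (genInv PH t) (if j ∈ S then 1 else 0) h)
          ((integrable_const 1).sub (integrable_transmission _ _)),
          integral_sub (integrable_const 1) (integrable_transmission _ _), integral_transmission]
        simp
        ring
      rw [← h2, measureReal_def]
      refine ENNReal.toReal_le_of_le_ofReal (integral_nonneg hnn) ?_
      rw [ofReal_integral_eq_lintegral_ofReal hint (ae_of_all _ hnn)]
      have hme := (measurableSet_error (inversionCode (genInv PH t) S book dec hdec) j).compl
      refine (Measure.prod_apply hme).le.trans (lintegral_mono fun h => ?_)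
      exact noise_inversionCode_le hγ S book dec hdec j hδ (herr j) h
    rw [Code.errorProb]
    calc _ ≤ (M : ℝ)⁻¹ * ∑ j : Fin M, (δ + (PH.real {h | gain h ≤ genInv PH t} -
          (if j ∈ S then (1 : ℝ) else 0) * PH.real {h | gain h = genInv PH t})) := by
          gcongr with j
          exact h1 j
      _ = δ + PH.real {h | gain h ≤ genInv PH t} -
          S.card / M * PH.real {h | gain h = genInv PH t} := by
          rw [Finset.sum_add_distrib, Finset.sum_sub_distrib, ← Finset.sum_mul, hsum]
          simp only [Finset.sum_const, Finset.card_univ, Fintype.card_fin, nsmul_eq_mul]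
          field_simp
          ring
      _ ≤ ε := by
          have h3 : (θ - 1 / M) * PH.real {h | gain h = genInv PH t} ≤
              S.card / M * PH.real {h | gain h = genInv PH t} := by
            refine mul_le_mul_of_nonneg_right ?_ hP0
            rw [le_div_iff₀ hM', sub_mul, one_div, inv_mul_cancel₀ hM'.ne']
            exact hSge
          have h4 : 1 / M * PH.real {h | gain h = genInv PH t} ≤ 1 / M :=
            mul_le_of_le_one_right (by positivity) hP1
          linarith

/-! ### Meta-converse -/

/-- The meta-converse for the fading channel: if the information density spectrum is bounded by an
affine function of the energy, the size of admissible codes is bounded. -/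
lemma converse_of_spectrum {n M : ℕ} (hn : 0 < n) {ρ ε w ω b T : ℝ} (hρ : 0 < ρ) (hw : 0 < w)
    (hω : 0 < ω) (hb : 0 ≤ b) (hγ : 0 < genInv PH ε) {c : Code n M} (hc : c.IsAdmissible PH ρ ε)
    (hspec : ∀ x : Fin n → ℂ, (noise n).real {z | T < infoDensity w x z} ≤
      energy x / (n * ω) + b) :
    genInv PH ε * (avgInvGain PH ε - ρ / ω) ≤ b + Real.exp T / M := by
  -- A decoder has a value, so there is at least one message.
  have hM : 0 < M := Fin.pos (c.dec (0, 0))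
  have hM' : (0 : ℝ) < M := by exact_mod_cast hM
  have hn' : (0 : ℝ) < n := by exact_mod_cast hn
  have := isProbabilityMeasure_gaussVec (n := n) (show 0 < 1 + w by positivity) 0
  have hemeas : ∀ j, Measurable fun h => energy (c.enc j h) := fun j =>
    measurable_energy.comp (c.measurable_enc j)
  have hfin : ∀ j, ∫⁻ h, ENNReal.ofReal (energy (c.enc j h)) ∂PH ≠ ∞ := by
    intro j htop
    have h1 : c.avgEnergy PH = ∞ := by
      rw [Code.avgEnergy, ENNReal.sum_eq_top.2 ⟨j, Finset.mem_univ j, htop⟩]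
      exact ENNReal.mul_top (by simp)
    have h2 := hc.1
    rw [h1] at h2
    exact ENNReal.ofReal_ne_top (top_le_iff.1 h2)
  have heint : ∀ j, Integrable (fun h => energy (c.enc j h)) PH := fun j =>
    (lintegral_ofReal_ne_top_iff_integrable (hemeas j).aestronglyMeasurable
      (ae_of_all _ fun h => energy_nonneg _)).1 (hfin j)
  have hpow : ∑ j, ∫ h, energy (c.enc j h) ∂PH ≤ M * (n * ρ) := by
    have h1 := hc.1
    have h2 : c.avgEnergy PH = ENNReal.ofReal ((M : ℝ)⁻¹ * ∑ j, ∫ h, energy (c.enc j h) ∂PH) := by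
      rw [Code.avgEnergy, ENNReal.ofReal_mul (by positivity), ENNReal.ofReal_inv_of_pos hM',
        ENNReal.ofReal_natCast, ENNReal.ofReal_sum_of_nonneg fun j _ =>
          integral_nonneg fun h => energy_nonneg _]
      congr 1
      refine Finset.sum_congr rfl fun j _ => ?_
      rw [ofReal_integral_eq_lintegral_ofReal (heint j) (ae_of_all _ fun h => energy_nonneg _)]
    rw [h2, ENNReal.ofReal_le_ofReal_iff (by positivity), inv_mul_le_iff₀ hM'] at h1
    exact h1
  -- the probability of transmission that the code achieves
  obtain ⟨p, hp⟩ : ∃ p : Fin M → ℂ → ℝ,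
    p = fun j h => min 1 (gain h * energy (c.enc j h) / (n * ω)) := ⟨_, rfl⟩
  have hp0 : ∀ j h, 0 ≤ p j h := fun j h => by
    rw [hp]
    exact le_min zero_le_one (by have := gain_nonneg h; have := energy_nonneg (c.enc j h); positivity)
  have hp1 : ∀ j h, p j h ≤ 1 := fun j h => by rw [hp]; exact min_le_left _ _
  have hpm : ∀ j, Measurable (p j) := fun j => by
    have := hemeas j
    rw [hp]
    fun_prop
  have hpi : ∀ j, Integrable (p j) PH := fun j =>
    Integrable.of_bound (hpm j).aestronglyMeasurable (C := 1) (ae_of_all _ fun h => by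
      rw [Real.norm_eq_abs, abs_of_nonneg (hp0 j h)]; exact hp1 j h)
  have hpg : ∀ j h, p j h / gain h ≤ energy (c.enc j h) / (n * ω) := fun j h => by
    have hE := energy_nonneg (c.enc j h)
    rcases eq_or_lt_of_le (gain_nonneg h) with h0 | h0
    · rw [← h0, div_zero]; positivity
    · rw [div_le_iff₀ h0, hp]
      refine (min_le_right _ _).trans (le_of_eq ?_)
      ring
  have hpg0 : ∀ j h, 0 ≤ p j h / gain h := fun j h => div_nonneg (hp0 j h) (gain_nonneg h)
  have hpgi : ∀ j, Integrable (fun h => p j h / gain h) PH := fun j =>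
    ((heint j).div_const (n * ω)).mono' ((hpm j).div measurable_gain).aestronglyMeasurable
      (ae_of_all _ fun h => by rw [Real.norm_eq_abs, abs_of_nonneg (hpg0 j h)]; exact hpg j h)
  -- For fixed fading, a correct decision has either information density above T, of probability at
  -- most p + b, or density at most T, and then the change of measure charges exp(T) times the
  -- output measure of the decoding region. The regions are disjoint, so the latter sum to at most
  -- exp(T).
  have hcorrect : ∀ h, ∑ j, (noise n).real
      {z | c.dec (output h (c.enc j h) z, h) = j} ≤ ∑ j, p j h + (M * b + Real.exp T) := by
    intro h
    have hD : ∀ j, MeasurableSet {y | c.dec (y, h) = j} := fun j =>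
      measurableSet_eq_fun (c.measurable_dec.comp measurable_prodMk_right) measurable_const
    have h1 : ∀ j, (noise n).real {z | c.dec (output h (c.enc j h) z, h) = j} ≤
        (p j h + b) + Real.exp T * (gaussVec (1 + w) 0).real {y | c.dec (y, h) = j} := by
      intro j
      obtain ⟨x, hx⟩ : ∃ x : Fin n → ℂ, x = fun i => h * c.enc j h i := ⟨_, rfl⟩
      have hEx : energy x = gain h * energy (c.enc j h) := by rw [hx, energy_mul]
      have ho : ∀ z, output h (c.enc j h) z = x + z := fun z => by rw [hx]; rfl
      have hb' : (noise n).real {z | T < infoDensity w x z} ≤ p j h + b := by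
        rw [hp]
        rcases le_total 1 (gain h * energy (c.enc j h) / (n * ω)) with h2 | h2
        · simp only [min_eq_left h2]
          exact measureReal_le_one.trans (by linarith)
        · simp only [min_eq_right h2]
          rw [← hEx]
          exact hspec x
      have hQ : (noise n).real {z | x + z ∈ {y | c.dec (y, h) = j} ∧ infoDensity w x z ≤ T} ≤
          Real.exp T * (gaussVec (1 + w) 0).real {y | c.dec (y, h) = j} := by
        rw [measureReal_def, measureReal_def]
        refine (ENNReal.toReal_mono (ENNReal.mul_ne_top ENNReal.ofReal_ne_top
          (measure_ne_top _ _)) (noise_infoDensity_le hw x T (hD j))).trans (le_of_eq ?_)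
        rw [ENNReal.toReal_mul, ENNReal.toReal_ofReal (Real.exp_pos T).le]
      calc _ ≤ (noise n).real ({z | T < infoDensity w x z} ∪
            {z | x + z ∈ {y | c.dec (y, h) = j} ∧ infoDensity w x z ≤ T}) := by
            refine measureReal_mono fun z hz => ?_
            have hz' : c.dec (output h (c.enc j h) z, h) = j := hz
            rw [ho] at hz'
            rcases lt_or_ge T (infoDensity w x z) with h2 | h2
            · exact Or.inl h2
            · exact Or.inr ⟨hz', h2⟩
        _ ≤ _ := (measureReal_union_le _ _).trans (add_le_add hb' hQ)
    have h2 : ∑ j, (gaussVec (1 + w) 0).real {y | c.dec (y, h) = j} ≤ 1 := by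
      rw [← measureReal_biUnion_finset (f := fun j => {y | c.dec (y, h) = j}) (fun i _ j _ hij => Set.disjoint_left.2
        fun y hy hy' => hij ((show c.dec (y, h) = i from hy).symm.trans hy')) fun j _ => hD j]
      exact measureReal_le_one
    calc _ ≤ ∑ j, ((p j h + b) + Real.exp T *
          (gaussVec (1 + w) 0).real {y | c.dec (y, h) = j}) := Finset.sum_le_sum fun j _ => h1 j
      _ = ∑ j, p j h + (M * b + Real.exp T *
          ∑ j, (gaussVec (1 + w) 0).real {y | c.dec (y, h) = j}) := by
          rw [Finset.sum_add_distrib, Finset.sum_add_distrib, ← Finset.mul_sum]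
          simp
          ring
      _ ≤ _ := by
          have := mul_le_mul_of_nonneg_left h2 (Real.exp_pos T).le
          linarith
  have hprob : ∀ j, (PH.prod (noise n)).real
      {p : ℂ × (Fin n → ℂ) | c.dec (output p.1 (c.enc j p.1) p.2, p.1) = j} =
      ∫ h, (noise n).real {z | c.dec (output h (c.enc j h) z, h) = j} ∂PH := by
    intro j
    rw [measureReal_def, Measure.prod_apply (measurableSet_error c j), ← integral_toReal]
    · rfl
    · exact (measurable_measure_prodMk_left (measurableSet_error c j)).aemeasurable
    · exact ae_of_all _ fun h => measure_lt_top _ _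
  have hprobi : ∀ j, Integrable
      (fun h => (noise n).real {z | c.dec (output h (c.enc j h) z, h) = j}) PH := fun j =>
    Integrable.of_bound ((measurable_measure_prodMk_left
      (measurableSet_error c j)).ennreal_toReal).aestronglyMeasurable (C := 1)
      (ae_of_all _ fun h => by
        rw [Real.norm_eq_abs, abs_of_nonneg measureReal_nonneg]; exact measureReal_le_one)
  have hsucc : M * (1 - ε) ≤ ∑ j, ∫ h, p j h ∂PH + (M * b + Real.exp T) := by
    have h1 : c.errorProb PH = (M : ℝ)⁻¹ * ∑ j : Fin M,
        (1 - ∫ h, (noise n).real {z | c.dec (output h (c.enc j h) z, h) = j} ∂PH) := by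
      rw [Code.errorProb]
      congr 1
      refine Finset.sum_congr rfl fun j _ => ?_
      rw [← hprob, ← probReal_compl_eq_one_sub (measurableSet_error c j)]
      rfl
    have h2 := hc.2
    rw [h1, inv_mul_le_iff₀ hM', Finset.sum_sub_distrib, ← integral_finsetSum _
      fun j _ => hprobi j] at h2
    have h3 := integral_mono (integrable_finsetSum Finset.univ fun j _ => hprobi j)
      ((integrable_finsetSum Finset.univ fun j _ => hpi j).add
        (integrable_const (M * b + Real.exp T))) hcorrect
    rw [integral_add' (integrable_finsetSum Finset.univ fun j _ => hpi j) (integrable_const _),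
      integral_finsetSum _ fun j _ => hpi j] at h3
    simp at h2 h3
    linarith
  -- The cost p/g is at most the transmitted energy over nω: this is where the knapsack meets the
  -- power constraint.
  have hknap : ∀ j, ∫ h, p j h ∂PH ≤ genInv PH ε * (∫ h, energy (c.enc j h) ∂PH) / (n * ω) +
      (1 - ε - genInv PH ε * avgInvGain PH ε) := by
    intro j
    have h1 := integral_le_of_transmission hγ (hpi j) (hpgi j) (hp0 j) (hp1 j)
      fun h hh => by rw [hp]; simp [hh]
    have h2 := integral_mono (hpgi j) ((heint j).div_const (n * ω)) (hpg j)
    rw [integral_div] at h2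
    have h3 := mul_le_mul_of_nonneg_left h2 hγ.le
    rw [mul_div_assoc]
    linarith
  have htot := Finset.sum_le_sum fun j (_ : j ∈ Finset.univ) => hknap j
  rw [Finset.sum_add_distrib, ← Finset.sum_div, ← Finset.mul_sum] at htot
  simp only [Finset.sum_const, Finset.card_univ, Fintype.card_fin, nsmul_eq_mul] at htot
  have hfinal : genInv PH ε * (∑ j, ∫ h, energy (c.enc j h) ∂PH) / (n * ω) ≤
      M * (genInv PH ε * (ρ / ω)) := by
    rw [div_le_iff₀ (by positivity)]
    calc _ ≤ genInv PH ε * (M * (n * ρ)) := mul_le_mul_of_nonneg_left hpow hγ.le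
      _ = _ := by field_simp
  have : M * (genInv PH ε * (avgInvGain PH ε - ρ / ω)) ≤ M * (b + Real.exp T / M) := by
    rw [mul_add, mul_div_cancel₀ _ hM'.ne']
    linarith
  exact le_of_mul_le_mul_left this hM'

end

/-! ### Finiteness, converse and achievability -/

lemma mul_twoTerms (PH : Measure ℂ) (ρ ε : ℝ) {n : ℕ} (hn : 0 < n) :
    n * twoTerms PH ρ ε n = n * Real.log (1 + ρ / avgInvGain PH ε) -
      √n * √(dispersion (ρ / avgInvGain PH ε)) * √(Real.log n) := by
  have hn' : (0 : ℝ) < n := by exact_mod_cast hn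
  have hs := Real.sqrt_pos.2 hn'
  have e : (n : ℝ) = √n * √n := (Real.mul_self_sqrt hn'.le).symm
  rw [twoTerms, capacity, Real.sqrt_div' _ hn'.le, mul_sub]
  congr 1
  nth_rewrite 1 [e]
  field_simp

section

variable {PH : Measure ℂ} [IsProbabilityMeasure PH]

lemma rateSet_nonempty {ρ ε : ℝ} (hε : 0 ≤ ε) (n : ℕ) : (rateSet PH ρ ε n).Nonempty := by
  refine ⟨_, 1, ⟨⟨fun _ _ => 0, fun _ => 0, fun _ => measurable_const, measurable_const⟩, ?_, ?_⟩,
    rfl⟩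
  · simp [Code.avgEnergy, energy_zero]
  · simpa [Code.errorProb] using hε

/-- At fixed n a crude spectrum suffices. With ω = 2w the linear term exceeds 1 beyond energy 2nw,
and below that the tail is at most b. The left side of the meta-converse is then 2b, which leaves b
≤ exp(T)/M. -/
lemma bddAbove_rateSet {ρ ε : ℝ} (hρ : 0 < ρ) (hε1 : ε < 1) (hγ : 0 < genInv PH ε) {n : ℕ}
    (hn : 0 < n) : BddAbove (rateSet PH ρ ε n) := by
  have hg := avgInvGain_pos hε1 hγ
  have hn' : (0 : ℝ) < n := by exact_mod_cast hn
  obtain ⟨w, hw⟩ : ∃ w, w = ρ / avgInvGain PH ε := ⟨_, rfl⟩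
  have hw0 : 0 < w := by rw [hw]; positivity
  obtain ⟨b, hb⟩ : ∃ b, b = genInv PH ε * avgInvGain PH ε / 4 := ⟨_, rfl⟩
  have hb0 : 0 < b := by rw [hb]; positivity
  obtain ⟨T, hT⟩ := exists_infoDensity_tail_le (n := n) hw0 (n * (2 * w)) hb0
  refine ⟨Real.log (Real.exp T / b) / n, ?_⟩
  rintro _ ⟨M, ⟨c, hc⟩, rfl⟩
  have hM' : (0 : ℝ) < M := by exact_mod_cast Fin.pos (c.dec (0, 0))
  have h := converse_of_spectrum (T := T) (b := b) (ω := 2 * w) hn hρ hw0 (by positivity) hb0.le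
    hγ hc fun x => by
      rcases le_total (energy x) (n * (2 * w)) with hx | hx
      · have h1 := hT x hx
        have h2 : 0 ≤ energy x / (n * (2 * w)) := div_nonneg (energy_nonneg x) (by positivity)
        linarith
      · have h1 : 1 ≤ energy x / (n * (2 * w)) := (one_le_div (by positivity)).2 hx
        exact measureReal_le_one.trans (by linarith)
  have e : genInv PH ε * (avgInvGain PH ε - ρ / (2 * w)) = 2 * b := by
    rw [hw, hb]; field_simp; ring
  rw [e] at h
  have h1 : b ≤ Real.exp T / M := by linarith
  rw [le_div_iff₀ hM'] at h1
  gcongr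
  rw [le_div_iff₀ hb0]
  linarith

/-- The converse part of the expansion. -/
lemma eventually_log_le {ρ ε : ℝ} (hρ : 0 < ρ) (hε1 : ε < 1) (hγ : 0 < genInv PH ε) :
    ∃ K : ℝ, ∀ᶠ n : ℕ in atTop, ∀ (M : ℕ) (c : Code n M), c.IsAdmissible PH ρ ε →
      Real.log M ≤ n * Real.log (1 + ρ / avgInvGain PH ε) -
        √n * √(dispersion (ρ / avgInvGain PH ε)) * √(Real.log n) + K * √n := by
  have hg := avgInvGain_pos hε1 hγ
  obtain ⟨w, hw⟩ : ∃ w, w = ρ / avgInvGain PH ε := ⟨_, rfl⟩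
  have hw0 : 0 < w := by rw [hw]; positivity
  -- Chosen so that the left side of the meta-converse is 6w/((w + K/√n)√n), at least 3/√n once K/√n
  -- ≤ w. The spectrum error uses 2/√n, and the remaining 1/√n bounds exp(T)/M from below.
  obtain ⟨K, hK⟩ : ∃ K, K = 6 * w / (genInv PH ε * avgInvGain PH ε) := ⟨_, rfl⟩
  have hK0 : 0 < K := by rw [hK]; positivity
  refine ⟨6 * √(dispersion w) + K / (1 + w) + 1, ?_⟩
  have hsq : Tendsto (fun n : ℕ => √(n : ℝ)) atTop atTop :=
    Real.tendsto_sqrt_atTop.comp tendsto_natCast_atTop_atTop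
  rw [← hw]
  filter_upwards [eventually_infoDensity_spectrum_le hw0 K hK0.le, eventually_gt_atTop 0,
    hsq.eventually_ge_atTop (K / w)] with n hs hn hnK M c hc
  have hn' : (0 : ℝ) < n := by exact_mod_cast hn
  have hM' : (0 : ℝ) < M := by exact_mod_cast Fin.pos (c.dec (0, 0))
  obtain ⟨t, ht⟩ : ∃ t, t = √(n : ℝ) := ⟨_, rfl⟩
  have ht0 : 0 < t := by rw [ht]; exact Real.sqrt_pos.2 hn'
  simp only [← ht] at hs hnK ⊢
  have h := converse_of_spectrum hn hρ hw0 (show 0 < w + K / t by positivity)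
    (show 0 ≤ 2 / t by positivity) hγ hc hs
  have h1 : 3 / t ≤ genInv PH ε * (avgInvGain PH ε - ρ / (w + K / t)) := by
    have e1 : ρ = w * avgInvGain PH ε := by rw [hw]; field_simp
    have e : genInv PH ε * (avgInvGain PH ε - ρ / (w + K / t)) =
        6 * w / (w + K / t) / t := by
      rw [e1]
      have e2 : genInv PH ε * avgInvGain PH ε * K = 6 * w := by rw [hK]; field_simp
      rw [← e2]
      field_simp
      ring
    rw [e, div_le_div_iff_of_pos_right ht0, le_div_iff₀ (by positivity)]
    have : K / t ≤ w := by
      rw [div_le_iff₀ hw0] at hnK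
      rw [div_le_iff₀ ht0]
      linarith
    linarith
  have h2 := h1.trans h
  obtain ⟨T, hT⟩ : ∃ T, T = n * Real.log (1 + w) - t * √(dispersion w) * √(Real.log n) +
    (6 * √(dispersion w) + K / (1 + w)) * t := ⟨_, rfl⟩
  rw [← hT] at h2
  have h3 : 1 / t ≤ Real.exp T / M := by
    have : 3 / t = 1 / t + 2 / t := by ring
    linarith
  rw [div_le_div_iff₀ ht0 hM', one_mul] at h3
  have h4 := Real.log_le_log hM' h3
  rw [Real.log_mul (Real.exp_pos T).ne' ht0.ne', Real.log_exp] at h4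
  have h5 := Real.log_le_sub_one_of_pos ht0
  linarith

/-- The achievability part of the expansion. -/
lemma eventually_exists_inversionCode {ρ ε δ : ℝ} (hρ : 0 < ρ) (hε1 : ε < 1) (hδ0 : 0 < δ)
    (hδ1 : δ < ε) (hγ : 0 < genInv PH (ε - δ)) :
    ∃ K : ℝ, ∀ᶠ n : ℕ in atTop, 0 < ε - 4 / √n ∧ ε - 4 / √n < ε ∧ ∃ M : ℕ,
      (∃ c : Code n M, c.IsAdmissible PH ρ ε ∧
        c.IsTruncatedInversion (genInv PH (ε - 4 / √n)) (ρ / avgInvGain PH (ε - 4 / √n))) ∧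
      n * Real.log (1 + ρ / avgInvGain PH ε) -
        √n * √(dispersion (ρ / avgInvGain PH ε)) * √(Real.log n) - K * √n ≤ Real.log M := by
  have hδε : 0 ≤ ε - δ := by linarith
  have hγε : 0 < genInv PH ε := hγ.trans_le (genInv_mono hδε (by linarith) hε1)
  have hg := avgInvGain_pos hε1 hγε
  obtain ⟨w, hw⟩ : ∃ w, w = ρ / avgInvGain PH ε := ⟨_, rfl⟩
  have hw0 : 0 < w := by rw [hw]; positivity
  -- Lowering the outage level by 4/√n raises ḡ by at most a/√n. To first order this costs energy (w
  -- a/ḡ_ε)√n, the back-off requested from the AWGN code.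
  obtain ⟨a, ha⟩ : ∃ a, a = 4 / genInv PH (ε - δ) := ⟨_, rfl⟩
  have ha0 : 0 < a := by rw [ha]; positivity
  obtain ⟨K, hK0, hK⟩ := exists_awgn_code hw0 (c := w * a / avgInvGain PH ε) (by positivity)
  refine ⟨K, ?_⟩
  rw [← hw]
  have hsq : Tendsto (fun n : ℕ => √(n : ℝ)) atTop atTop :=
    Real.tendsto_sqrt_atTop.comp tendsto_natCast_atTop_atTop
  have hC : 0 < Real.log (1 + w) := Real.log_pos (by linarith)
  have hκ := tendsto_sqrt_log_add_two_pow_div.eventually_le_const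
    (show 0 < Real.log (1 + w) / (√(dispersion w) + K + 1) by positivity)
  filter_upwards [hK, eventually_gt_atTop 0, hsq.eventually_ge_atTop (4 / δ), hκ] with n hn hn0 hnδ
    hnκ
  have hn' : (0 : ℝ) < n := by exact_mod_cast hn0
  obtain ⟨t, ht⟩ : ∃ t, t = √(n : ℝ) := ⟨_, rfl⟩
  have ht0 : 0 < t := by rw [ht]; exact Real.sqrt_pos.2 hn'
  have hnt : (n : ℝ) = t ^ 2 := by rw [ht, Real.sq_sqrt hn'.le]
  simp only [← ht] at hn hnδ hnκ ⊢
  have h4 : 4 / t ≤ δ := by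
    rw [div_le_iff₀ hδ0] at hnδ
    rw [div_le_iff₀ ht0]
    linarith
  have h4' : 0 < 4 / t := by positivity
  have hs0 : 0 < ε - 4 / t := by linarith
  have hs1 : ε - 4 / t < 1 := by linarith
  have hγt : genInv PH (ε - δ) ≤ genInv PH (ε - 4 / t) := genInv_mono hδε (by linarith) hs1
  have hγt0 := hγ.trans_le hγt
  refine ⟨hs0, by linarith, ?_⟩
  obtain ⟨M, hM0, hM, book, dec, hdec, hbook⟩ := hn
  have hM' : (0 : ℝ) < M := by exact_mod_cast hM0
  refine ⟨M, ?_, hM⟩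
  -- The margin 4/√n is spent as 3/√n on decoding errors and 1/√n on the rounding loss 1/M.
  refine exists_inversionCode (δ := 3 / t) hM0 hρ hs0.le hs1 hγt0 book dec hdec (by positivity)
    (fun j => (hbook j).1.trans ?_) (fun j => (hbook j).2) ?_
  · have h5 : avgInvGain PH (ε - 4 / t) ≤ avgInvGain PH ε + a / t := by
      refine (avgInvGain_le_add hs0.le (by linarith) hε1 hγt0).trans ?_
      have : (ε - (ε - 4 / t)) / genInv PH (ε - 4 / t) ≤ a / t := by
        rw [ha, sub_sub_cancel, div_right_comm]
        gcongr
      linarith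
    have h6 : ρ / (avgInvGain PH ε + a / t) ≤ ρ / avgInvGain PH (ε - 4 / t) :=
      div_le_div_of_nonneg_left hρ.le (avgInvGain_pos hs1 hγt0) h5
    have h7 : n * w - w * a / avgInvGain PH ε * t ≤ n * (ρ / (avgInvGain PH ε + a / t)) := by
      have e1 : ρ = w * avgInvGain PH ε := by rw [hw]; field_simp
      rw [e1, hnt]
      obtain ⟨g, hgdef⟩ : ∃ g, g = avgInvGain PH ε := ⟨_, rfl⟩
      rw [← hgdef] at hg ⊢
      -- Convexity of x ↦ w g/(g + x): it lies above its tangent at 0.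
      have e2 : t ^ 2 * (w * g / (g + a / t)) - (t ^ 2 * w - w * a / g * t) =
          w * a ^ 2 * t / (g * (g * t + a)) := by
        field_simp
        ring
      have : 0 ≤ w * a ^ 2 * t / (g * (g * t + a)) := by positivity
      linarith
    exact h7.trans (mul_le_mul_of_nonneg_left h6 hn'.le)
  -- M grows exponentially, so 1/M ≤ 1/√n with much to spare; the cubic limit is reused merely to
  -- bound √(ln n) against √n.
  · have h8 : t ≤ M := by
      rw [← Real.log_le_log_iff ht0 hM']
      refine le_trans ?_ hM
      have h9 := Real.log_le_sub_one_of_pos ht0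
      obtain ⟨u, hu⟩ : ∃ u, u = √(Real.log n) := ⟨_, rfl⟩
      have hu0 : 0 ≤ u := by rw [hu]; positivity
      rw [← hu] at hnκ ⊢
      rw [div_le_div_iff₀ ht0 (by positivity)] at hnκ
      have hu3 : u + 1 ≤ (u + 2) ^ 3 := by
        have : 0 ≤ u ^ 3 + 6 * u ^ 2 + 11 * u := by positivity
        nlinarith
      have hσ0 : 0 ≤ √(dispersion w) := Real.sqrt_nonneg _
      have h10 : √(dispersion w) * u + K + 1 ≤ Real.log (1 + w) * t := by
        refine le_trans ?_ hnκ
        have : (u + 1) * (√(dispersion w) + K + 1) ≤ (u + 2) ^ 3 * (√(dispersion w) + K + 1) :=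
          mul_le_mul_of_nonneg_right hu3 (by positivity)
        have : 0 ≤ √(dispersion w) + K * u + u := by positivity
        nlinarith
      have h11 := mul_le_mul_of_nonneg_left h10 ht0.le
      rw [hnt]
      linarith
    have h12 : 1 / (M : ℝ) ≤ 1 / t := one_div_le_one_div_of_le ht0 h8
    have e : (4 : ℝ) / t = 3 / t + 1 / t := by ring
    linarith

end

end QuasiStatic

end

theorem theorem2 (PH : Measure ℂ) [IsProbabilityMeasure PH] (ρ ε : ℝ)
    (hρ : 0 < ρ) (hε0 : 0 < ε) (hε1 : ε < 1)
    (hG : Integrable QuasiStatic.gain PH)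
    (hF : ∃ δ : ℝ, 0 < δ ∧ δ < ε ∧ 0 < QuasiStatic.genInv PH (ε - δ)) :
    -- the supremum in the definition of the maximal rate is finite
    (∀ n : ℕ, 0 < n →
      (QuasiStatic.rateSet PH ρ ε n).Nonempty ∧ BddAbove (QuasiStatic.rateSet PH ρ ε n)) ∧
    -- the expansion of the maximal rate
    (fun n : ℕ => QuasiStatic.maxRate PH ρ ε n - QuasiStatic.twoTerms PH ρ ε n)
      =O[atTop] (fun n : ℕ => 1 / √(n : ℝ)) ∧
    -- truncated channel inversion achieves the expansion
    ∃ (t : ℕ → ℝ) (M : ℕ → ℕ),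
      Tendsto t atTop (𝓝 ε) ∧
      (∀ᶠ n : ℕ in atTop, 0 < t n ∧ t n < ε ∧
        ∃ c : QuasiStatic.Code n (M n),
          c.IsAdmissible PH ρ ε ∧
          c.IsTruncatedInversion (QuasiStatic.genInv PH (t n))
            (ρ / QuasiStatic.avgInvGain PH (t n))) ∧
      (fun n : ℕ => Real.log (M n) / n - QuasiStatic.twoTerms PH ρ ε n)
        =O[atTop] (fun n : ℕ => 1 / √(n : ℝ)) := by
  obtain ⟨δ, hδ0, hδ1, hγ⟩ := hF
  have hγε : 0 < QuasiStatic.genInv PH ε :=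
    hγ.trans_le (QuasiStatic.genInv_mono (by linarith) (by linarith) hε1)
  obtain ⟨K₁, hK₁⟩ := QuasiStatic.eventually_log_le hρ hε1 hγε
  obtain ⟨K₂, hK₂⟩ := QuasiStatic.eventually_exists_inversionCode hρ hε1 hδ0 hδ1 hγ
  -- One sequence of codes serves both claims: its rate bounds the supremum from below and, being
  -- admissible, itself obeys the converse.
  obtain ⟨M, hM⟩ := (hK₂.mono fun n hn => hn.2.2).choice
  have hup : ∀ᶠ n : ℕ in atTop, ∀ (m : ℕ) (c : QuasiStatic.Code n m), c.IsAdmissible PH ρ ε →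
      Real.log m / n ≤ QuasiStatic.twoTerms PH ρ ε n + K₁ * (1 / √n) := by
    filter_upwards [hK₁, eventually_gt_atTop 0] with n hn hn0 m c hc
    have hn' : (0 : ℝ) < n := by exact_mod_cast hn0
    have h := hn m c hc
    rw [← QuasiStatic.mul_twoTerms PH ρ ε hn0] at h
    rw [div_le_iff₀ hn', add_mul, mul_assoc, one_div_mul_eq_div, Real.div_sqrt]
    linarith
  have hlow : ∀ᶠ n : ℕ in atTop,
      QuasiStatic.twoTerms PH ρ ε n - K₂ * (1 / √n) ≤ Real.log (M n) / n := by
    filter_upwards [hM, eventually_gt_atTop 0] with n hn hn0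
    have hn' : (0 : ℝ) < n := by exact_mod_cast hn0
    have h := hn.2
    rw [← QuasiStatic.mul_twoTerms PH ρ ε hn0] at h
    rw [le_div_iff₀ hn', sub_mul, mul_assoc, one_div_mul_eq_div, Real.div_sqrt]
    linarith
  have habs : ∀ (n : ℕ) (r : ℝ), r ≤ QuasiStatic.twoTerms PH ρ ε n + K₁ * (1 / √n) →
      QuasiStatic.twoTerms PH ρ ε n - K₂ * (1 / √n) ≤ r →
      ‖r - QuasiStatic.twoTerms PH ρ ε n‖ ≤ max K₁ K₂ * ‖1 / √(n : ℝ)‖ := by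
    intro n r h1 h2
    have h0 : 0 ≤ 1 / √(n : ℝ) := by positivity
    have h3 := mul_le_mul_of_nonneg_right (le_max_left K₁ K₂) h0
    have h4 := mul_le_mul_of_nonneg_right (le_max_right K₁ K₂) h0
    rw [Real.norm_eq_abs, Real.norm_eq_abs, abs_of_nonneg h0, abs_le]
    constructor <;> linarith
  refine ⟨fun n hn => ⟨QuasiStatic.rateSet_nonempty hε0.le n,
    QuasiStatic.bddAbove_rateSet hρ hε1 hγε hn⟩, ?_, fun n => ε - 4 / √n, M, ?_, ?_, ?_⟩
  · refine IsBigO.of_bound (max K₁ K₂) ?_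
    filter_upwards [hup, hlow, hM, eventually_gt_atTop 0] with n h1 h2 h3 hn
    refine habs n _ (csSup_le (QuasiStatic.rateSet_nonempty hε0.le n) ?_) (h2.trans
      (le_csSup (QuasiStatic.bddAbove_rateSet hρ hε1 hγε hn) ?_))
    · rintro _ ⟨m, ⟨c, hc⟩, rfl⟩
      exact h1 m c hc
    · obtain ⟨c, hc, -⟩ := h3.1
      exact ⟨M n, ⟨c, hc⟩, rfl⟩
  · have hsq : Tendsto (fun n : ℕ => √(n : ℝ)) atTop atTop :=
      Real.tendsto_sqrt_atTop.comp tendsto_natCast_atTop_atTop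
    simpa using (hsq.const_div_atTop 4).const_sub ε
  · filter_upwards [hK₂, hM] with n h1 h2
    exact ⟨h1.1, h1.2.1, h2.1⟩
  · refine IsBigO.of_bound (max K₁ K₂) ?_
    filter_upwards [hup, hlow, hM] with n h1 h2 h3
    obtain ⟨c, hc, -⟩ := h3.1
    exact habs n _ (h1 _ c hc) h2
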